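/- Let $M$ be a smooth manifold without boundary, finite dimensional or more generally modelled on a real Banach space. A pseudo-Riemannian metric on $M$ is a smooth symmetric $2$-tensor field $g$ such that $v\mapsto g(v,\cdot)$ is a bijection from each tangent space $T_xM$ onto its (continuous) dual; in finite dimension this means that $g$ is nondegenerate. Its sectional curvature is $$K^g(a,b)=\frac{g(R^g(a,b)b,a)}{g(a,a)g(b,b)-g(a,b)^2},\qquad R^g(A,B)=[\nabla^g_A,\nabla^g_B]-\nabla^g_{[A,B]},$$ where $\nabla^g$ is the Levi-Civita connection and $a,b\in T_xM$ span a nondegenerate plane, i.e. $g(a,a)g(b,b)-g(a,b)^2\neq 0$. We write $K^g\ge 0$ (resp. $K^g\le 0$) if this holds for all $x\in M$ and all such $a,b$. A metric is called definite if it is positive definite or negative definite. Suppose that $M$ carries a smooth free action $m:\mathbb R_{>0}\times M\to M$ of the multiplicative group $\mathbb R_{>0}$, write $m_\lambda=m(\lambda,\cdot)$, and let $P_x=\frac{d}{dt}\big|_{t=0}m(e^t,x)$ be the vector field generated by it. Let $g$ be a pseudo-Riemannian metric on $M$, let $f:M\to\mathbb R_{>0}$ be smooth, and let $\alpha\in\mathbb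 R\setminus\{0\}$. The pair $(g,f)$ is a homogeneous pair of degree $\alpha$ if $m_\lambda^*g=\lambda^\alpha g$ and $m_\lambda^*f=\lambda^\alpha f$ for all $\lambda>0$, and $g(P,\cdot)=df$. Let $(g,f)$ be a homogeneous pair of degree $\alpha>1$, and set $$\hat g=\frac{df\otimes df}{f}+(1-\alpha)\,g .$$ Suppose that $K^g\ge 0$ and that $\hat g$ is definite. Then for every $\beta\in\mathbb R$ the tensor $f^\beta\hat g$ is a pseudo-Riemannian metric on $M$ and $K^{f^\beta\hat g}\le 0$. -/

import Mathlib

open scoped Manifold ContDiff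

noncomputable section

/-- Covariant two-tensor fields on a manifold `M` without boundary, modelled on the normed
space `E`. -/
abbrev TwoTensorField (E : Type*) [NormedAddCommGroup E] [NormedSpace ℝ E]
    (M : Type*) [TopologicalSpace M] [ChartedSpace E M] :=
  ∀ x : M, TangentSpace 𝓘(ℝ, E) x →L[ℝ] TangentSpace 𝓘(ℝ, E) x →L[ℝ] ℝ

/-! ### Calculus in a chart

`G : E → E →L[ℝ] E →L[ℝ] ℝ` is the coordinate expression of a metric. -/

section Chart

variable {E : Type*} [NormedAddCommGroup E] [NormedSpace ℝ E]

/-- `w ↦ (D_u G)(v, w) + (D_v G)(u, w) - (D_w G)(u, v)` at `y`: the right-hand side of the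
Koszul formula for constant vector fields. -/
def koszulForm (G : E → E →L[ℝ] E →L[ℝ] ℝ) (y u v : E) : E →L[ℝ] ℝ :=
  fderiv ℝ G y u v + fderiv ℝ G y v u - ((fderiv ℝ G y).flip u).flip v

/-- The Christoffel symbol `Γ_y(u, v)` of the Levi-Civita connection, determined by
`2 G_y(Γ_y(u, v), w) = (D_u G)(v, w) + (D_v G)(u, w) - (D_w G)(u, v)`. -/
def christoffel (G : E → E →L[ℝ] E →L[ℝ] ℝ) (y u v : E) : E :=
  (1 / 2 : ℝ) • (G y).inverse (koszulForm G y u v)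

/-- The curvature `R(u, v) w = ∇_u ∇_v w - ∇_v ∇_u w` at `y`, for constant (hence commuting)
vector fields `u, v, w`. -/
def curvatureInChart (G : E → E →L[ℝ] E →L[ℝ] ℝ) (y u v w : E) : E :=
  fderiv ℝ (fun z ↦ christoffel G z v w) y u - fderiv ℝ (fun z ↦ christoffel G z u w) y v
    + christoffel G y u (christoffel G y v w) - christoffel G y v (christoffel G y u w)

end Chart

section Manifold

variable {E : Type*} [NormedAddCommGroup E] [NormedSpace ℝ E]
  {M : Type*} [TopologicalSpace M] [ChartedSpace E M]

/-- A pseudo-Riemannian metric: a smooth symmetric two-tensor field `g` such that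
`v ↦ g(v, ·)` is a bijection from the tangent space onto its (continuous) dual. In finite
dimension the last condition says that `g(v, ·) = 0` only for `v = 0`. -/
structure IsPseudoRiemannianMetric [IsManifold 𝓘(ℝ, E) ∞ M] (g : TwoTensorField E M) :
    Prop where
  smooth : ContMDiff 𝓘(ℝ, E) (𝓘(ℝ, E).prod 𝓘(ℝ, E →L[ℝ] E →L[ℝ] ℝ)) ∞
    (fun x ↦ Bundle.TotalSpace.mk' (E →L[ℝ] E →L[ℝ] ℝ)
      (E := fun x : M ↦ TangentSpace 𝓘(ℝ, E) x →L[ℝ] TangentSpace 𝓘(ℝ, E) x →L[ℝ] ℝ) x (g x))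
  symm : ∀ (x : M) (u v : TangentSpace 𝓘(ℝ, E) x), g x u v = g x v u
  nondegenerate : ∀ x : M, Function.Bijective (g x)

/-- `g` is definite: positive definite or negative definite. -/
def IsDefinite (g : TwoTensorField E M) : Prop :=
  (∀ (x : M) (v : TangentSpace 𝓘(ℝ, E) x), v ≠ 0 → 0 < g x v v) ∨
    (∀ (x : M) (v : TangentSpace 𝓘(ℝ, E) x), v ≠ 0 → g x v v < 0)

/-- The coordinate expression of `g` in the chart at `x₀`: the pullback of `g` under the inverse
of the chart (each tangent space of `M` is by definition a copy of `E`). -/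
def inChart (g : TwoTensorField E M) (x₀ : M) (y : E) : E →L[ℝ] E →L[ℝ] ℝ :=
  let φ := extChartAt 𝓘(ℝ, E) x₀
  let L : E →L[ℝ] E := mfderiv 𝓘(ℝ, E) 𝓘(ℝ, E) φ.symm y
  let B : E →L[ℝ] E →L[ℝ] ℝ := g (φ.symm y)
  B.bilinearComp L L

/-- The coordinates of a tangent vector at `x` in the chart at `x`. -/
def tangentCoord (x : M) (a : TangentSpace 𝓘(ℝ, E) x) : E :=
  mfderiv 𝓘(ℝ, E) 𝓘(ℝ, E) (extChartAt 𝓘(ℝ, E) x) x a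

/-- `g(R(a, b) b, a)` for tangent vectors `a, b` at `x`. -/
def curvatureForm (g : TwoTensorField E M) (x : M) (a b : TangentSpace 𝓘(ℝ, E) x) : ℝ :=
  let y := extChartAt 𝓘(ℝ, E) x x
  inChart g x y
    (curvatureInChart (inChart g x) y (tangentCoord x a) (tangentCoord x b) (tangentCoord x b))
    (tangentCoord x a)

/-- `g(a, a) g(b, b) - g(a, b)²`. It is nonzero exactly when `a, b` are linearly independent and
`g` is nondegenerate on the plane they span. -/
def gramDet (g : TwoTensorField E M) (x : M) (a b : TangentSpace 𝓘(ℝ, E) x) : ℝ :=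
  g x a a * g x b b - g x a b ^ 2

/-- The sectional curvature of the plane spanned by `a, b`; meaningful when `gramDet g x a b ≠ 0`,
that is, for nondegenerate planes. -/
def sectionalCurvature (g : TwoTensorField E M) (x : M) (a b : TangentSpace 𝓘(ℝ, E) x) : ℝ :=
  curvatureForm g x a b / gramDet g x a b

/-- `m` is a smooth free action of the multiplicative group of positive reals on `M`. Only the
values `m l` with `0 < l` matter. -/
structure IsSmoothFreeAction (m : ℝ → M → M) : Prop where
  one : ∀ x, m 1 x = x
  mul : ∀ l k : ℝ, 0 < l → 0 < k → ∀ x, m (l * k) x = m l (m k x)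
  free : ∀ l : ℝ, 0 < l → ∀ x, m l x = x → l = 1
  smooth : ContMDiffOn (𝓘(ℝ, ℝ).prod 𝓘(ℝ, E)) 𝓘(ℝ, E) ∞
    (fun p : ℝ × M ↦ m p.1 p.2) (Set.Ioi 0 ×ˢ Set.univ)

/-- The vector field `P` generated by the action: the velocity of `t ↦ m (exp t) x` at `t = 0`,
a tangent vector at `m (exp 0) x = x`. -/
def generator (m : ℝ → M → M) (x : M) : TangentSpace 𝓘(ℝ, E) x :=
  (mfderiv 𝓘(ℝ, ℝ) 𝓘(ℝ, E) (fun t : ℝ ↦ m (Real.exp t) x) 0 : ℝ →L[ℝ] E) (1 : ℝ)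

/-- The differential of a real function at `x`, as a continuous linear form. -/
def differential (f : M → ℝ) (x : M) : TangentSpace 𝓘(ℝ, E) x →L[ℝ] ℝ :=
  mvfderiv 𝓘(ℝ, E) f x

/-- `(g, f)` is a homogeneous pair of degree `α` with respect to the action `m`. -/
structure IsHomogeneousPair [IsManifold 𝓘(ℝ, E) ∞ M] (m : ℝ → M → M)
    (g : TwoTensorField E M) (f : M → ℝ) (α : ℝ) : Prop where
  action : IsSmoothFreeAction (E := E) m
  metric : IsPseudoRiemannianMetric g
  smooth : ContMDiff 𝓘(ℝ, E) 𝓘(ℝ, ℝ) ∞ f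
  pos : ∀ x, 0 < f x
  degree_ne_zero : α ≠ 0
  homogeneous_metric : ∀ l : ℝ, 0 < l → ∀ (x : M) (u v : TangentSpace 𝓘(ℝ, E) x),
    g (m l x) (mfderiv 𝓘(ℝ, E) 𝓘(ℝ, E) (m l) x u) (mfderiv 𝓘(ℝ, E) 𝓘(ℝ, E) (m l) x v)
      = l ^ α * g x u v
  homogeneous_fun : ∀ l : ℝ, 0 < l → ∀ x : M, f (m l x) = l ^ α * f x
  generator_eq : ∀ x : M, g x (generator m x) = differential f x

/-- `ĝ = (df ⊗ df) / f + (1 - α) g`. -/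
def hatMetric (g : TwoTensorField E M) (f : M → ℝ) (α : ℝ) : TwoTensorField E M :=
  fun x ↦ (f x)⁻¹ • (differential f x).smulRight (differential f x) + (1 - α) • g x

/-- `f ^ β g`. -/
def conformalPow (f : M → ℝ) (β : ℝ) (g : TwoTensorField E M) : TwoTensorField E M :=
  fun x ↦ (f x ^ β) • g x

end Manifold

end

/-! Differentiating the homogeneity conditions along the action gives df(P) = αf and L_P g = αg.
Together with g(P, ·) = df, the latter says that the Hessian of f is (α/2)g, hence ∇P = (α/2) id
(`hessian`, `fderiv_field`). By the Ricci identity R^g takes values in ker df, and its symmetries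
then show that it vanishes when P is put in any slot (`fderiv_curvature`, `curvature_field_right`).

P is also the ĝ-gradient of f. So the Levi-Civita connection of f^β ĝ differs from that of g by an
explicit tensor in f, df, g and P (`christoffel_hatChart`), whose covariant derivative involves the
same ingredients only. If a', b' are the projections of a, b to ker df along P, the curvature form
of f^β ĝ at (a, b) turns out (`curvatureForm_hatChart`) to be f^β times (1-α) g(R(a',b')b',a') -
(α(α-1)/4) (1 + (α-1)(β+1)²) f⁻¹ (g(a',a')g(b',b') - g(a',b')²).

Since ĝ(P, P) = αf > 0, a definite ĝ is positive definite. On ker df it equals (1-α)g, so g is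
negative definite there and the Gram determinant of a', b' is nonnegative. With K^g ≥ 0 and α > 1
both terms are nonpositive. The computation is done in charts, where (g, f, P) becomes (G, F, X). -/

noncomputable section

/-! ### Levi-Civita connection and curvature of a metric in a chart. -/

section ChartMetric

set_option maxSynthPendingDepth 3

variable {E : Type*} [NormedAddCommGroup E] [NormedSpace ℝ E]

/-- `G` is the coordinate expression of a pseudo-Riemannian metric on the open set `U`. -/
structure IsChartMetric (G : E → E →L[ℝ] E →L[ℝ] ℝ) (U : Set E) : Prop where
  isOpen : IsOpen U
  smooth : ContDiffOn ℝ ∞ G U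
  symm : ∀ z ∈ U, ∀ u v, G z u v = G z v u
  bijective : ∀ z ∈ U, Function.Bijective (G z)

namespace IsChartMetric

variable {G : E → E →L[ℝ] E →L[ℝ] ℝ} {U : Set E} {z : E}

theorem contDiffAt (hG : IsChartMetric G U) (hz : z ∈ U) : ContDiffAt ℝ ∞ G z :=
  hG.smooth.contDiffAt (hG.isOpen.mem_nhds hz)

theorem hasFDerivAt_apply (hG : IsChartMetric G U) (hz : z ∈ U) {V W : E → E}
    {V' W' : E →L[ℝ] E} (hV : HasFDerivAt V V' z) (hW : HasFDerivAt W W' z) (u : E) :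
    fderiv ℝ (fun y ↦ G y (V y) (W y)) z u =
      fderiv ℝ G z u (V z) (W z) + G z (V' u) (W z) + G z (V z) (W' u) := by
  have h := ((hG.contDiffAt hz).differentiableAt (by simp)).hasFDerivAt
  rw [((h.clm_apply hV).clm_apply hW).fderiv]
  simp
  ring

theorem fderiv_apply (hG : IsChartMetric G U) (hz : z ∈ U) (u v w : E) :
    fderiv ℝ (fun y ↦ G y v w) z u = fderiv ℝ G z u v w := by
  simpa using hG.hasFDerivAt_apply hz (hasFDerivAt_const v z) (hasFDerivAt_const w z) u

theorem fderiv_symm (hG : IsChartMetric G U) (hz : z ∈ U) (u v w : E) :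
    fderiv ℝ G z u v w = fderiv ℝ G z u w v := by
  rw [← hG.fderiv_apply hz, ← hG.fderiv_apply hz]
  congr 1
  apply Filter.EventuallyEq.fderiv_eq
  filter_upwards [hG.isOpen.mem_nhds hz] with y hy using hG.symm y hy v w

theorem eq_of_forall (hG : IsChartMetric G U) (hz : z ∈ U) {u v : E}
    (h : ∀ w, G z u w = G z v w) : u = v :=
  (hG.bijective z hz).1 (ContinuousLinearMap.ext h)

theorem curvature_skew (G : E → E →L[ℝ] E →L[ℝ] ℝ) (z u v w : E) :
    curvatureInChart G z u v w = -curvatureInChart G z v u w := by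
  simp only [curvatureInChart]; abel

theorem fderiv_fderiv_apply (hG : IsChartMetric G U) (hz : z ∈ U) (u v w w' : E) :
    fderiv ℝ (fderiv ℝ G) z v u w w' = fderiv ℝ (fun y ↦ fderiv ℝ G y u w w') z v := by
  have h1 : HasFDerivAt (fderiv ℝ G) _ z :=
    (((hG.contDiffAt hz).fderiv_right (m := ∞) (by simp)).differentiableAt
      (by simp)).hasFDerivAt
  rw [(((h1.clm_apply (hasFDerivAt_const u z)).clm_apply (hasFDerivAt_const w z)).clm_apply
    (hasFDerivAt_const w' z)).fderiv]
  simp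

variable [CompleteSpace E]

/-- Completeness enters here: by the open mapping theorem the algebraic inverse of G z is
continuous. -/
theorem isInvertible (hG : IsChartMetric G U) (hz : z ∈ U) : (G z).IsInvertible :=
  ⟨ContinuousLinearEquiv.ofBijective (G z)
    (LinearMap.ker_eq_bot.2 (hG.bijective z hz).1) (LinearMap.range_eq_top.2 (hG.bijective z hz).2),
    by ext; simp⟩

theorem koszul (hG : IsChartMetric G U) (hz : z ∈ U) (u v w : E) :
    2 * G z (christoffel G z u v) w =
      fderiv ℝ G z u v w + fderiv ℝ G z v u w - fderiv ℝ G z w u v := by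
  have h : G z ((G z).inverse (koszulForm G z u v)) = koszulForm G z u v :=
    (hG.isInvertible hz).self_apply_inverse _
  have h' : 2 * G z (christoffel G z u v) w = G z ((G z).inverse (koszulForm G z u v)) w := by
    simp [christoffel]
  rw [h', h]
  simp [koszulForm]

theorem christoffel_eq (hG : IsChartMetric G U) (hz : z ∈ U) {u v c : E}
    (h : ∀ w, 2 * G z c w = fderiv ℝ G z u v w + fderiv ℝ G z v u w - fderiv ℝ G z w u v) :
    christoffel G z u v = c :=
  hG.eq_of_forall hz fun w ↦ by linarith [h w, hG.koszul hz u v w]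

theorem christoffel_symm (hG : IsChartMetric G U) (hz : z ∈ U) (u v : E) :
    christoffel G z u v = christoffel G z v u :=
  hG.christoffel_eq hz fun w ↦ by
    rw [hG.koszul hz, hG.fderiv_symm hz w u v]; ring

theorem christoffel_add (hG : IsChartMetric G U) (hz : z ∈ U) (u v v' : E) :
    christoffel G z u (v + v') = christoffel G z u v + christoffel G z u v' :=
  hG.christoffel_eq hz fun w ↦ by
    have h1 := hG.koszul hz u v w
    have h2 := hG.koszul hz u v' w
    simp only [map_add, add_apply] at h1 h2 ⊢
    linarith

theorem christoffel_smul (hG : IsChartMetric G U) (hz : z ∈ U) (c : ℝ) (u v : E) :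
    christoffel G z u (c • v) = c • christoffel G z u v :=
  hG.christoffel_eq hz fun w ↦ by
    have h1 := hG.koszul hz u v w
    simp only [map_smul, smul_apply, smul_eq_mul] at h1 ⊢
    linear_combination c * h1

theorem compat (hG : IsChartMetric G U) (hz : z ∈ U) (u v w : E) :
    fderiv ℝ G z u v w = G z (christoffel G z u v) w + G z v (christoffel G z u w) := by
  have h1 := hG.koszul hz u v w
  have h2 := hG.koszul hz u w v
  rw [hG.symm z hz v]
  linarith [hG.fderiv_symm hz u v w, hG.fderiv_symm hz v u w, hG.fderiv_symm hz w u v]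

theorem contDiffAt_christoffel (hG : IsChartMetric G U) (hz : z ∈ U) (u v : E) :
    ContDiffAt ℝ ∞ (fun y ↦ christoffel G y u v) z := by
  have h1 : ContDiffAt ℝ ∞ (fderiv ℝ G) z := (hG.contDiffAt hz).fderiv_right (by simp)
  have h2 : ContDiffAt ℝ ∞ (fun y ↦ (G y).inverse) z :=
    (hG.isInvertible hz).contDiffAt_map_inverse.comp z (hG.contDiffAt hz)
  have h3 : ContDiffAt ℝ ∞ (fun y ↦ ((fderiv ℝ G y).flip u).flip v) z := by
    let A := ContinuousLinearMap.flipₗᵢ ℝ E E (E →L[ℝ] ℝ)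
    let B := ContinuousLinearMap.flipₗᵢ ℝ E E ℝ
    have : ContDiffAt ℝ ∞ (fun y ↦ A (fderiv ℝ G y)) z := A.contDiff.contDiffAt.comp z h1
    have := this.clm_apply (contDiffAt_const (c := u))
    have : ContDiffAt ℝ ∞ (fun y ↦ B (A (fderiv ℝ G y) u)) z := B.contDiff.contDiffAt.comp z this
    exact this.clm_apply (contDiffAt_const (c := v))
  have h4 : ContDiffAt ℝ ∞ (fun y ↦ koszulForm G y u v) z :=
    (((h1.clm_apply contDiffAt_const).clm_apply contDiffAt_const).add
      ((h1.clm_apply contDiffAt_const).clm_apply contDiffAt_const)).sub h3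
  exact (h2.clm_apply h4).const_smul _

theorem hasFDerivAt_christoffel (hG : IsChartMetric G U) (hz : z ∈ U) (u v : E) :
    HasFDerivAt (fun y ↦ christoffel G y u v) (fderiv ℝ (fun y ↦ christoffel G y u v) z) z :=
  ((hG.contDiffAt_christoffel hz u v).differentiableAt (by simp)).hasFDerivAt

/-! ### Symmetries of the curvature -/

theorem curvature_bianchi (hG : IsChartMetric G U) (hz : z ∈ U) (u v w : E) :
    curvatureInChart G z u v w + curvatureInChart G z v w u + curvatureInChart G z w u v = 0 := by
  have h (a b : E) : (fun y ↦ christoffel G y a b) =ᶠ[nhds z] fun y ↦ christoffel G y b a := by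
    filter_upwards [hG.isOpen.mem_nhds hz] with y hy using hG.christoffel_symm hy a b
  simp only [curvatureInChart]
  rw [(h w v).fderiv_eq, (h u w).fderiv_eq, (h v u).fderiv_eq, hG.christoffel_symm hz w v,
    hG.christoffel_symm hz u w, hG.christoffel_symm hz v u]
  abel

theorem curvature_add_right (hG : IsChartMetric G U) (hz : z ∈ U) (u v w w' : E) :
    curvatureInChart G z u v (w + w') =
      curvatureInChart G z u v w + curvatureInChart G z u v w' := by
  have h (a : E) : fderiv ℝ (fun y ↦ christoffel G y a (w + w')) z =
      fderiv ℝ (fun y ↦ christoffel G y a w) z + fderiv ℝ (fun y ↦ christoffel G y a w') z := by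
    rw [← ((hG.hasFDerivAt_christoffel hz a w).add (hG.hasFDerivAt_christoffel hz a w')).fderiv]
    apply Filter.EventuallyEq.fderiv_eq
    filter_upwards [hG.isOpen.mem_nhds hz] with y hy using hG.christoffel_add hy a w w'
  simp only [curvatureInChart, h, hG.christoffel_add hz, add_apply]
  abel

theorem curvature_smul_right (hG : IsChartMetric G U) (hz : z ∈ U) (c : ℝ) (u v w : E) :
    curvatureInChart G z u v (c • w) = c • curvatureInChart G z u v w := by
  have h (a : E) : fderiv ℝ (fun y ↦ christoffel G y a (c • w)) z =
      c • fderiv ℝ (fun y ↦ christoffel G y a w) z := by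
    rw [← ((hG.hasFDerivAt_christoffel hz a w).const_smul c).fderiv]
    apply Filter.EventuallyEq.fderiv_eq
    filter_upwards [hG.isOpen.mem_nhds hz] with y hy using hG.christoffel_smul hy c a w
  simp only [curvatureInChart, h, hG.christoffel_smul hz, smul_apply]
  module

/-- Ricci identity for the parallel tensor G: `compat` expresses second derivatives of G through Γ,
and antisymmetrizing them in u, v gives zero on one side and the two curvature terms on the other.
-/
theorem curvature_skew_right (hG : IsChartMetric G U) (hz : z ∈ U) (u v w w' : E) :
    G z (curvatureInChart G z u v w) w' = -G z (curvatureInChart G z u v w') w := by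
  have key (a b : E) : fderiv ℝ (fderiv ℝ G) z a b w w' =
      G z (christoffel G z a (christoffel G z b w)) w'
      + G z (christoffel G z b w) (christoffel G z a w')
      + G z (fderiv ℝ (fun y ↦ christoffel G y b w) z a) w'
      + G z (christoffel G z a w) (christoffel G z b w')
      + G z w (christoffel G z a (christoffel G z b w'))
      + G z w (fderiv ℝ (fun y ↦ christoffel G y b w') z a) := by
    rw [hG.fderiv_fderiv_apply hz]
    have : (fun y ↦ fderiv ℝ G y b w w') =ᶠ[nhds z]
        ((fun y ↦ G y (christoffel G y b w) w') + fun y ↦ G y w (christoffel G y b w')) := by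
      filter_upwards [hG.isOpen.mem_nhds hz] with y hy using hG.compat hy b w w'
    have hd := (hG.contDiffAt hz).differentiableAt (by simp)
    rw [this.fderiv_eq, fderiv_add
      ((hd.clm_apply (hG.hasFDerivAt_christoffel hz b w).differentiableAt).clm_apply
        (differentiableAt_const _))
      ((hd.clm_apply (differentiableAt_const _)).clm_apply
        (hG.hasFDerivAt_christoffel hz b w').differentiableAt), add_apply,
      hG.hasFDerivAt_apply hz (hG.hasFDerivAt_christoffel hz b w) (hasFDerivAt_const w' z),
      hG.hasFDerivAt_apply hz (hasFDerivAt_const w z) (hG.hasFDerivAt_christoffel hz b w'),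
      hG.compat hz, hG.compat hz]
    simp
    ring
  have hs : fderiv ℝ (fderiv ℝ G) z u v = fderiv ℝ (fderiv ℝ G) z v u :=
    ((hG.contDiffAt hz).isSymmSndFDerivAt
      (by rw [minSmoothness_of_isRCLikeNormedField]; exact WithTop.coe_le_coe.2 (le_top (a := 2)))).eq
        u v
  have h := key u v
  rw [hs, key v u] at h
  rw [hG.symm z hz _ w]
  simp only [curvatureInChart, map_add, map_sub, add_apply,
    sub_apply]
  linarith

/-- The octahedron argument: the Bianchi identity for the four cyclic rotations of the arguments,
combined using skewness in each pair. -/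
theorem curvature_pair_symm (hG : IsChartMetric G U) (hz : z ∈ U) (u v w w' : E) :
    G z (curvatureInChart G z u v w) w' = G z (curvatureInChart G z w w' u) v := by
  have b (a b c d : E) : G z (curvatureInChart G z a b c) d + G z (curvatureInChart G z b c a) d
      + G z (curvatureInChart G z c a b) d = 0 := by
    simpa using congrArg (G z · d) (hG.curvature_bianchi hz a b c)
  have s (a b c d : E) : G z (curvatureInChart G z a b c) d =
      - G z (curvatureInChart G z b a c) d := by
    rw [curvature_skew]; simp
  have t := hG.curvature_skew_right hz
  linarith [b u v w w', b v w w' u, b w w' u v, b w' u v w, t u v w w', t v w w' u, t w w' u v,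
    t w' u v w, t w u v w', t v w' w u, s u v w w', s u w v w', s v w' w u, t u w v w',
    s v w u w', s w w' u v, s w' v w u, s w' u v w, s u w' v w, t u w' v w]

end IsChartMetric

end ChartMetric

/-! ### Homogeneous pairs in a chart: Hessian of F and curvature of G. -/

section HomogeneousChart

set_option maxSynthPendingDepth 3

/-- `f⁻¹ ℓ ⊗ ℓ + (1 - α) B` is nondegenerate if `B` is, and the vector dual to `ℓ` satisfies
`ℓ X = α f`. -/
theorem bijective_smulRight_add {V : Type*} [AddCommGroup V] [Module ℝ V] [TopologicalSpace V]
    [IsTopologicalAddGroup V] [ContinuousSMul ℝ V] {B : V →L[ℝ] V →L[ℝ] ℝ}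
    (hB : Function.Bijective B) {l : V →L[ℝ] ℝ} {X : V} {f α c : ℝ} (hX : B X = l)
    (hl : l X = α * f) (hf : f ≠ 0) (hα : α ≠ 1) (hc : c ≠ 0) :
    Function.Bijective (c • (f⁻¹ • l.smulRight l + (1 - α) • B)) := by
  have hα' : 1 - α ≠ 0 := sub_ne_zero.2 hα.symm
  constructor
  · refine (injective_iff_map_eq_zero _).2 fun v hv ↦ ?_
    have h1 : (f⁻¹ * l v) • l + (1 - α) • B v = 0 := by
      have := (smul_eq_zero_iff_right hc).1 hv
      simpa [smul_smul] using this
    have h2 : (f⁻¹ * l v) • X + (1 - α) • v = 0 := hB.1 (by simpa [hX] using h1)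
    have h3 : l v = 0 := by
      have := congrArg l h2
      simp only [map_add, map_smul, hl, smul_eq_mul, map_zero] at this
      field_simp at this
      linarith
    simpa [h3, hα'] using h2
  · intro ξ
    obtain ⟨w, rfl⟩ := hB.2 ξ
    -- The form in question sends X to c(α + 1 - α) l = c l, so subtracting (f⁻¹ l w) X from w
    -- removes the rank-one term and leaves c(1 - α) B w.
    refine ⟨(c * (1 - α))⁻¹ • (w - (f⁻¹ * l w) • X), ?_⟩
    ext u
    simp [hX, hl]
    field_simp
    ring

variable {E : Type*} [NormedAddCommGroup E] [NormedSpace ℝ E]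

/-- `(G, F)` is the coordinate expression of a homogeneous pair of degree `α` on `U`, where `X`
generates the action. -/
structure IsHomogeneousChart (G : E → E →L[ℝ] E →L[ℝ] ℝ) (F : E → ℝ) (X : E → E) (α : ℝ)
    (U : Set E) : Prop extends IsChartMetric G U where
  smooth_fun : ContDiffOn ℝ ∞ F U
  pos : ∀ z ∈ U, 0 < F z
  differentiable_field : ∀ z ∈ U, DifferentiableAt ℝ X z
  field_eq : ∀ z ∈ U, G z (X z) = fderiv ℝ F z
  fderiv_field_eq : ∀ z ∈ U, fderiv ℝ F z (X z) = α * F z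
  lie : ∀ z ∈ U, ∀ u v, fderiv ℝ G z (X z) u v + G z (fderiv ℝ X z u) v + G z u (fderiv ℝ X z v)
    = α * G z u v

/-- The coordinate expression of `f ^ β ĝ`. -/
def hatChart (G : E → E →L[ℝ] E →L[ℝ] ℝ) (F : E → ℝ) (α β : ℝ) (z : E) : E →L[ℝ] E →L[ℝ] ℝ :=
  (F z ^ β) • ((F z)⁻¹ • (fderiv ℝ F z).smulRight (fderiv ℝ F z) + (1 - α) • G z)

theorem hatChart_apply (G : E → E →L[ℝ] E →L[ℝ] ℝ) (F : E → ℝ) (α β : ℝ) (z u v : E) :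
    hatChart G F α β z u v = F z ^ β *
      ((F z)⁻¹ * (fderiv ℝ F z u * fderiv ℝ F z v) + (1 - α) * G z u v) := by
  simp [hatChart]
  ring

namespace IsHomogeneousChart

variable {G : E → E →L[ℝ] E →L[ℝ] ℝ} {F : E → ℝ} {X : E → E} {α : ℝ} {U : Set E} {z : E}

theorem contDiffAt_fun (h : IsHomogeneousChart G F X α U) (hz : z ∈ U) : ContDiffAt ℝ ∞ F z :=
  h.smooth_fun.contDiffAt (h.isOpen.mem_nhds hz)

theorem contDiffAt_fderiv (h : IsHomogeneousChart G F X α U) (hz : z ∈ U) :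
    ContDiffAt ℝ ∞ (fderiv ℝ F) z :=
  (h.contDiffAt_fun hz).fderiv_right (by simp)

theorem hasFDerivAt_fderiv (h : IsHomogeneousChart G F X α U) (hz : z ∈ U) :
    HasFDerivAt (fderiv ℝ F) (fderiv ℝ (fderiv ℝ F) z) z :=
  ((h.contDiffAt_fderiv hz).differentiableAt (by simp)).hasFDerivAt

theorem isChartMetric_hatChart (h : IsHomogeneousChart G F X α U) (hα : α ≠ 1) (β : ℝ) :
    IsChartMetric (hatChart G F α β) U where
  isOpen := h.isOpen
  smooth z hz := by
    have hF := h.contDiffAt_fun hz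
    have hF0 := (h.pos z hz).ne'
    have hd := h.contDiffAt_fderiv hz
    let A := ContinuousLinearMap.smulRightL ℝ E (E →L[ℝ] ℝ)
    have hA : ContDiffAt ℝ ∞ (fun y ↦ A (fderiv ℝ F y)) z := A.contDiff.contDiffAt.comp z hd
    exact ((hF.rpow_const_of_ne hF0).smul
      (((hF.inv hF0).smul (hA.clm_apply hd)).add
        ((h.contDiffAt hz).const_smul _))).contDiffWithinAt
  symm z hz u v := by
    rw [hatChart_apply, hatChart_apply, h.symm z hz u v, mul_comm (fderiv ℝ F z u)]
  bijective z hz := bijective_smulRight_add (h.bijective z hz) (h.field_eq z hz)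
    (h.fderiv_field_eq z hz) (h.pos z hz).ne' hα (Real.rpow_pos_of_pos (h.pos z hz) β).ne'

theorem fderiv_hatChart (h : IsHomogeneousChart G F X α U) (hα : α ≠ 1) (β : ℝ) (hz : z ∈ U)
    (u v w : E) : fderiv ℝ (hatChart G F α β) z u v w =
      F z ^ β * (β * (F z)⁻¹ * fderiv ℝ F z u *
        ((F z)⁻¹ * (fderiv ℝ F z v * fderiv ℝ F z w) + (1 - α) * G z v w)
      - (F z)⁻¹ ^ 2 * fderiv ℝ F z u * (fderiv ℝ F z v * fderiv ℝ F z w)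
      + (F z)⁻¹ * (fderiv ℝ (fderiv ℝ F) z u v * fderiv ℝ F z w
        + fderiv ℝ F z v * fderiv ℝ (fderiv ℝ F) z u w)
      + (1 - α) * fderiv ℝ G z u v w) := by
  rw [← (h.isChartMetric_hatChart hα β).fderiv_apply hz]
  simp only [hatChart_apply]
  have hF0 := (h.pos z hz).ne'
  have hF : HasFDerivAt F _ z := ((h.contDiffAt_fun hz).differentiableAt (by simp)).hasFDerivAt
  have hd := h.hasFDerivAt_fderiv hz
  have hG : HasFDerivAt G _ z := ((h.contDiffAt hz).differentiableAt (by simp)).hasFDerivAt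
  have e (a : E) := hd.clm_apply (hasFDerivAt_const a z)
  have eG := (hG.clm_apply (hasFDerivAt_const v z)).clm_apply (hasFDerivAt_const w z)
  have hi : HasFDerivAt (fun y ↦ (F y)⁻¹) _ z := (hasDerivAt_inv hF0).comp_hasFDerivAt z hF
  have hr := hF.rpow_const (p := β) (Or.inl hF0)
  have hrw : F z ^ (β - 1) = F z ^ β * (F z)⁻¹ := by
    rw [Real.rpow_sub_one hF0, div_eq_mul_inv]
  rw [(hr.fun_mul ((hi.fun_mul ((e v).fun_mul (e w))).fun_add (eG.const_mul (1 - α)))).fderiv]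
  simp [hrw]
  ring

theorem fderiv_field_apply (h : IsHomogeneousChart G F X α U) (hz : z ∈ U) (u v : E) :
    fderiv ℝ G z u (X z) v + G z (fderiv ℝ X z u) v = fderiv ℝ (fderiv ℝ F) z u v := by
  have h1 := h.hasFDerivAt_apply hz (h.differentiable_field z hz).hasFDerivAt
    (hasFDerivAt_const v z) u
  have h2 : (fun y ↦ G y (X y) v) =ᶠ[nhds z] fun y ↦ fderiv ℝ F y v := by
    filter_upwards [h.isOpen.mem_nhds hz] with y hy
    rw [h.field_eq y hy]
  rw [h2.fderiv_eq, ((h.hasFDerivAt_fderiv hz).clm_apply (hasFDerivAt_const v z)).fderiv] at h1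
  simpa using h1.symm

theorem fderiv_fderiv_comm (h : IsHomogeneousChart G F X α U) (hz : z ∈ U) (u v : E) :
    fderiv ℝ (fderiv ℝ F) z u v = fderiv ℝ (fderiv ℝ F) z v u :=
  ((h.contDiffAt_fun hz).isSymmSndFDerivAt
    (by rw [minSmoothness_of_isRCLikeNormedField]; exact WithTop.coe_le_coe.2 (le_top (a := 2)))).eq
        u v

variable [CompleteSpace E]

/-- The Hessian of `F` is `(α / 2) G`. -/
theorem hessian (h : IsHomogeneousChart G F X α U) (hz : z ∈ U) (u v : E) :
    fderiv ℝ (fderiv ℝ F) z u v = fderiv ℝ F z (christoffel G z u v) + α / 2 * G z u v := by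
  -- Koszul paired with X: differentiating G(X, ·) = dF supplies the terms D_u G(v, X) and D_v G(u,
  -- X), and L_X G = αG supplies D_X G(u, v). The terms containing DX cancel.
  have h1 := h.koszul hz u v (X z)
  rw [h.symm z hz, h.field_eq z hz] at h1
  have h2 := h.fderiv_field_apply hz u v
  have h3 := h.fderiv_field_apply hz v u
  rw [h.symm z hz, ← h.fderiv_fderiv_comm hz] at h3
  linarith [h.lie z hz u v, h.fderiv_symm hz u v (X z), h.fderiv_symm hz v u (X z)]

/-- Raising an index in the Hessian identity, X being the gradient of F: this is ∇X = (α/2) id. -/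
theorem fderiv_field (h : IsHomogeneousChart G F X α U) (hz : z ∈ U) (u : E) :
    fderiv ℝ X z u = (α / 2) • u - christoffel G z u (X z) := by
  refine h.eq_of_forall hz fun v ↦ ?_
  have h1 := h.fderiv_field_apply hz u v
  rw [h.hessian hz, h.compat hz, h.field_eq z hz] at h1
  simp only [map_sub, map_smul, sub_apply, smul_apply, smul_eq_mul]
  linarith

/-- Ricci identity for the one-form dF: ∇dF = (α/2)G is parallel, so antisymmetrizing the third
derivative of F leaves only the curvature term. -/
theorem fderiv_curvature (h : IsHomogeneousChart G F X α U) (hz : z ∈ U) (u v w : E) :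
    fderiv ℝ F z (curvatureInChart G z u v w) = 0 := by
  have key (a b : E) : fderiv ℝ (fderiv ℝ (fderiv ℝ F)) z a b w =
      fderiv ℝ F z (christoffel G z a (christoffel G z b w))
      + α / 2 * G z a (christoffel G z b w)
      + fderiv ℝ F z (fderiv ℝ (fun y ↦ christoffel G y b w) z a)
      + α / 2 * (G z (christoffel G z a b) w + G z b (christoffel G z a w)) := by
    have h2 : HasFDerivAt (fderiv ℝ (fderiv ℝ F)) _ z :=
      (((h.contDiffAt_fderiv hz).fderiv_right (m := ∞) (by simp)).differentiableAt
        (by simp)).hasFDerivAt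
    have h3 := ((h2.clm_apply (hasFDerivAt_const b z)).clm_apply (hasFDerivAt_const w z)).fderiv
    have h4 : (fun y ↦ fderiv ℝ (fderiv ℝ F) y b w) =ᶠ[nhds z]
        (fun y ↦ fderiv ℝ F y (christoffel G y b w) + α / 2 * G y b w) := by
      filter_upwards [h.isOpen.mem_nhds hz] with y hy using h.hessian hy b w
    have hG : HasFDerivAt G _ z := ((h.contDiffAt hz).differentiableAt (by simp)).hasFDerivAt
    rw [h4.fderiv_eq, (((h.hasFDerivAt_fderiv hz).clm_apply
      (h.hasFDerivAt_christoffel hz b w)).fun_add (((hG.clm_apply (hasFDerivAt_const b z)).clm_apply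
        (hasFDerivAt_const w z)).const_mul (α / 2))).fderiv] at h3
    have h5 := congrArg (· a) h3
    simp at h5
    rw [← h5, h.hessian hz, h.compat hz]
    ring
  have hs : fderiv ℝ (fderiv ℝ (fderiv ℝ F)) z u v = fderiv ℝ (fderiv ℝ (fderiv ℝ F)) z v u :=
    ((h.contDiffAt_fderiv hz).isSymmSndFDerivAt
      (by rw [minSmoothness_of_isRCLikeNormedField]; exact WithTop.coe_le_coe.2 (le_top (a := 2)))).eq
        u v
  have h1 := key u v
  rw [hs, key v u, h.christoffel_symm hz v u] at h1
  simp only [curvatureInChart, map_add, map_sub]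
  linarith

theorem curvature_field_right (h : IsHomogeneousChart G F X α U) (hz : z ∈ U) (u v : E) :
    curvatureInChart G z u v (X z) = 0 := by
  refine h.eq_of_forall hz fun w' ↦ ?_
  rw [h.curvature_skew_right hz, h.symm z hz, h.field_eq z hz, h.fderiv_curvature hz]
  simp

end IsHomogeneousChart

end HomogeneousChart

/-! ### Connection and curvature of f^β ĝ. -/

section HatCurvature

set_option maxSynthPendingDepth 3

variable {E : Type*} [NormedAddCommGroup E] [NormedSpace ℝ E]

/-- The difference tensor between the Levi-Civita connections of `F ^ β Ĝ` and `G`, for suitable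
coefficients `k, l, m`. -/
def hatDifference (G : E → E →L[ℝ] E →L[ℝ] ℝ) (F : E → ℝ) (X : E → E) (k l m : ℝ) (z u v : E) : E :=
  ((F z)⁻¹ * (k * G z u v - l * ((F z)⁻¹ * (fderiv ℝ F z u * fderiv ℝ F z v)))) • X z +
    (m * (F z)⁻¹) • (fderiv ℝ F z u • v + fderiv ℝ F z v • u)

namespace IsHomogeneousChart

variable {G : E → E →L[ℝ] E →L[ℝ] ℝ} {F : E → ℝ} {X : E → E} {α : ℝ} {U : Set E} {z : E}

theorem differentiableAt_hatDifference_and_fderiv (h : IsHomogeneousChart G F X α U)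
    (k l m : ℝ) (hz : z ∈ U) (v w : E) : DifferentiableAt ℝ (fun y ↦ hatDifference G F X k l m y v w) z ∧ ∀ u,
    fderiv ℝ (fun y ↦ hatDifference G F X k l m y v w) z u =
      (-(F z)⁻¹ ^ 2 * fderiv ℝ F z u *
          (k * G z v w - l * ((F z)⁻¹ * (fderiv ℝ F z v * fderiv ℝ F z w)))
        + (F z)⁻¹ * (k * fderiv ℝ G z u v w
          + l * ((F z)⁻¹ ^ 2 * fderiv ℝ F z u * (fderiv ℝ F z v * fderiv ℝ F z w))
          - l * ((F z)⁻¹ * (fderiv ℝ (fderiv ℝ F) z u v * fderiv ℝ F z w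
            + fderiv ℝ F z v * fderiv ℝ (fderiv ℝ F) z u w)))) • X z
      + ((F z)⁻¹ * (k * G z v w - l * ((F z)⁻¹ * (fderiv ℝ F z v * fderiv ℝ F z w)))) •
        fderiv ℝ X z u
      - (m * (F z)⁻¹ ^ 2 * fderiv ℝ F z u) • (fderiv ℝ F z v • w + fderiv ℝ F z w • v)
      + (m * (F z)⁻¹) •
        (fderiv ℝ (fderiv ℝ F) z u v • w + fderiv ℝ (fderiv ℝ F) z u w • v) := by
  have hF0 := (h.pos z hz).ne'
  have hF : HasFDerivAt F _ z := ((h.contDiffAt_fun hz).differentiableAt (by simp)).hasFDerivAt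
  have hd := h.hasFDerivAt_fderiv hz
  have hG : HasFDerivAt G _ z := ((h.contDiffAt hz).differentiableAt (by simp)).hasFDerivAt
  have e (a : E) := hd.clm_apply (hasFDerivAt_const a z)
  have eG := (hG.clm_apply (hasFDerivAt_const v z)).clm_apply (hasFDerivAt_const w z)
  have hi : HasFDerivAt (fun y ↦ (F y)⁻¹) _ z := (hasDerivAt_inv hF0).comp_hasFDerivAt z hF
  have hX := (h.differentiable_field z hz).hasFDerivAt
  have key := ((hi.fun_mul ((eG.const_mul k).fun_sub
    ((hi.fun_mul ((e v).fun_mul (e w))).const_mul l))).fun_smul hX).fun_add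
      ((hi.const_mul m).fun_smul (((e v).fun_smul (hasFDerivAt_const w z)).fun_add
        ((e w).fun_smul (hasFDerivAt_const v z))))
  refine ⟨key.differentiableAt, fun u ↦ ?_⟩
  unfold hatDifference
  rw [key.fderiv]
  simp
  module

variable [CompleteSpace E]

/-- X is the gradient of F for Ĝ as well, since F⁻¹ · αF + (1 - α) = 1. For β = 0 the Hessian
identity gives the difference F⁻¹((α/2) G - (1/2) F⁻¹ dF ⊗ dF) X. The conformal factor adds (β/2)
F⁻¹ (dF(u) v + dF(v) u - Ĝ(u, v) X), and expanding Ĝ yields the three constants. -/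
theorem christoffel_hatChart (h : IsHomogeneousChart G F X α U) (hα : α ≠ 1) (β : ℝ) (hz : z ∈ U)
    (u v : E) : christoffel (hatChart G F α β) z u v = christoffel G z u v +
      hatDifference G F X ((α - (1 - α) * β) / 2) ((β + 1) / 2) (β / 2) z u v := by
  refine (h.isChartMetric_hatChart hα β).christoffel_eq hz fun w ↦ ?_
  have hi : F z * (F z)⁻¹ = 1 := mul_inv_cancel₀ (h.pos z hz).ne'
  have hK := h.koszul hz u v w
  have hX : G z (X z) w = fderiv ℝ F z w := by rw [h.field_eq z hz]
  simp only [h.fderiv_hatChart hα β hz, hatChart_apply, hatDifference, map_add, map_smul,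
    add_apply, smul_apply, smul_eq_mul, h.fderiv_field_eq z hz, hX, h.hessian hz,
    h.christoffel_symm hz w, h.christoffel_symm hz v u, h.symm z hz v u, h.symm z hz w]
  linear_combination (F z ^ β * (1 - α)) * hK +
    (2 * F z ^ β * α * fderiv ℝ F z w * ((F z)⁻¹ * ((α - (1 - α) * β) / 2 * G z u v
      - (β + 1) / 2 * ((F z)⁻¹ * (fderiv ℝ F z u * fderiv ℝ F z v))))) * hi

/-- With D the difference tensor, the change of curvature is (∇_u D)(v, w) - (∇_v D)(u, w) + D(u,
D(v, w)) - D(v, D(u, w)). Inserting ∇G = 0, ∇dF = (α/2) G and ∇X = (α/2) id, all Christoffel symbols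
cancel. The values of k, l, m serve only to identify D; the remaining algebra holds for any k, l, m.
-/
theorem curvature_hatChart (h : IsHomogeneousChart G F X α U) (hα : α ≠ 1) (β : ℝ) (hz : z ∈ U)
    (u v w : E) {k l m : ℝ} (hk : k = (α - (1 - α) * β) / 2) (hl : l = (β + 1) / 2)
    (hm : m = β / 2) :
    curvatureInChart (hatChart G F α β) z u v w = curvatureInChart G z u v w
      + ((F z)⁻¹ * (α / 2 * (k - m) + k * m * α)) • (G z v w • u - G z u w • v)
      + ((F z)⁻¹ ^ 2 * (m - l * α / 2 + m ^ 2 - l * m * α) * fderiv ℝ F z w) •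
        (fderiv ℝ F z v • u - fderiv ℝ F z u • v)
      + ((F z)⁻¹ ^ 2 * (l * α / 2 - k + k ^ 2 - k * l * α) *
        (fderiv ℝ F z u * G z v w - fderiv ℝ F z v * G z u w)) • X z := by
  have hd (a b c : E) : fderiv ℝ (fun y ↦ christoffel (hatChart G F α β) y a b) z c =
      fderiv ℝ (fun y ↦ christoffel G y a b) z c
        + fderiv ℝ (fun y ↦ hatDifference G F X k l m y a b) z c := by
    have : (fun y ↦ christoffel (hatChart G F α β) y a b) =ᶠ[nhds z]
        fun y ↦ christoffel G y a b + hatDifference G F X k l m y a b := by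
      filter_upwards [h.isOpen.mem_nhds hz] with y hy
      rw [h.christoffel_hatChart hα β hy, hk, hl, hm]
    rw [this.fderiv_eq, fderiv_fun_add (h.hasFDerivAt_christoffel hz a b).differentiableAt
      (h.differentiableAt_hatDifference_and_fderiv k l m hz a b).1, add_apply]
  have hX (a : E) : G z (X z) a = fderiv ℝ F z a := by rw [h.field_eq z hz]
  simp only [curvatureInChart, hd, (h.differentiableAt_hatDifference_and_fderiv k l m hz _ _).2,
    h.christoffel_hatChart hα β hz, ← hk, ← hl, ← hm, h.hessian hz, h.fderiv_field hz,
    h.compat hz, h.christoffel_symm hz v u]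
  simp only [hatDifference, map_add, map_smul, smul_eq_mul,
    h.christoffel_add hz, h.christoffel_smul hz, h.fderiv_field_eq z hz, hX,
    h.symm z hz _ (X z), h.christoffel_symm hz v u, h.symm z hz v u,
    h.symm z hz v (christoffel G z u _)]
  have hF0 := (h.pos z hz).ne'
  generalize F z = f at *
  match_scalars <;> field_simp <;> ring

end IsHomogeneousChart

end HatCurvature

/-! ### Sign of the curvature form of f^β ĝ. -/

section HatSign

set_option maxSynthPendingDepth 3

/-- The Cauchy-Schwarz inequality with its equality case, for a bilinear form that is positive
definite on the kernel of `l`. -/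
theorem gram_nonneg_of_pos_on_ker {V : Type*} [AddCommGroup V] [Module ℝ V] [TopologicalSpace V]
    [IsTopologicalAddGroup V] [ContinuousSMul ℝ V] {B : V →L[ℝ] V →L[ℝ] ℝ}
    (hs : ∀ u v, B u v = B v u) (l : V →L[ℝ] ℝ) (hB : ∀ v, l v = 0 → v ≠ 0 → 0 < B v v)
    {a b : V} (ha : l a = 0) (hb : l b = 0) :
    0 ≤ B a a * B b b - B a b ^ 2 ∧
      (B a a * B b b - B a b ^ 2 = 0 → b = 0 ∨ ∃ t : ℝ, a = t • b) := by
  rcases eq_or_ne b 0 with rfl | hb0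
  · simp
  have hq := hB b hb hb0
  have hc : B b b * B (a - (B a b / B b b) • b) (a - (B a b / B b b) • b) =
      B a a * B b b - B a b ^ 2 := by
    simp only [map_sub, map_smul, sub_apply, smul_apply, smul_eq_mul, hs b a]
    field_simp
    ring
  rcases eq_or_ne (a - (B a b / B b b) • b) 0 with h0 | h0
  · refine ⟨by rw [← hc, h0]; simp, fun _ ↦ Or.inr ⟨_, sub_eq_zero.1 h0⟩⟩
  · have hp := mul_pos hq (hB _ (by simp [ha, hb]) h0)
    rw [hc] at hp
    exact ⟨hp.le, fun h ↦ absurd h hp.ne'⟩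

variable {E : Type*} [NormedAddCommGroup E] [NormedSpace ℝ E]

namespace IsHomogeneousChart

variable {G : E → E →L[ℝ] E →L[ℝ] ℝ} {F : E → ℝ} {X : E → E} {α : ℝ} {U : Set E} {z : E}
  [CompleteSpace E]

theorem curvature_sub_smul_field (h : IsHomogeneousChart G F X α U) (hz : z ∈ U) (u v w : E)
    (c : ℝ) : curvatureInChart G z u v (w - c • X z) = curvatureInChart G z u v w := by
  rw [sub_eq_add_neg, ← neg_smul, h.curvature_add_right hz, h.curvature_smul_right hz,
    h.curvature_field_right hz, smul_zero, add_zero]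

/-- Pair symmetry and skewness carry each slot in turn to the third one, where X is annihilated. -/
theorem curvatureForm_sub_smul_field (h : IsHomogeneousChart G F X α U) (hz : z ∈ U) (a b : E)
    (s t : ℝ) :
    G z (curvatureInChart G z (a - s • X z) (b - t • X z) (b - t • X z)) (a - s • X z) =
      G z (curvatureInChart G z a b b) a := by
  rw [h.curvature_sub_smul_field hz, h.curvature_pair_symm hz, h.curvature_sub_smul_field hz,
    h.curvature_pair_symm hz, h.curvature_skew_right hz, h.curvature_sub_smul_field hz,
    ← h.curvature_skew_right hz, h.curvature_pair_symm hz, h.curvature_skew_right hz,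
    h.curvature_sub_smul_field hz, IsChartMetric.curvature_skew]
  simp

/-- In particular planes containing X are flat. The constant is (1 - α)(α/2)(k - m + 2km) with the
k, m of `christoffel_hatChart`, where k - m + 2km = (1 + (α - 1)(β + 1)²)/2. -/
theorem curvatureForm_hatChart (h : IsHomogeneousChart G F X α U) (hα : 1 < α) (β : ℝ)
    (hz : z ∈ U) (a b : E) {a' b' : E} (ha : a' = a - (fderiv ℝ F z a / (α * F z)) • X z)
    (hb : b' = b - (fderiv ℝ F z b / (α * F z)) • X z) :
    hatChart G F α β z (curvatureInChart (hatChart G F α β) z a b b) a =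
      F z ^ β * ((1 - α) * G z (curvatureInChart G z a' b' b') a'
        - α * (α - 1) / 4 * (1 + (α - 1) * (β + 1) ^ 2) * (F z)⁻¹ *
          (G z a' a' * G z b' b' - G z a' b' ^ 2)) := by
  have hF0 := (h.pos z hz).ne'
  have hα0 : α ≠ 0 := by positivity
  have hX (a : E) : G z (X z) a = fderiv ℝ F z a := by rw [h.field_eq z hz]
  have hR : G z (curvatureInChart G z a' b' b') a' = G z (curvatureInChart G z a b b) a := by
    rw [ha, hb, h.curvatureForm_sub_smul_field hz]
  rw [hR, h.curvature_hatChart hα.ne' β hz a b b rfl rfl rfl, hatChart_apply, ha, hb]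
  simp only [map_add, map_sub, map_smul, add_apply, sub_apply, smul_apply, smul_eq_mul,
    h.fderiv_curvature hz, h.fderiv_field_eq z hz, hX, h.symm z hz _ (X z), h.symm z hz b a]
  generalize F z ^ β = r
  generalize F z = f at *
  field_simp
  ring

/-- On ker dF the positive definite form is F^β (1 - α) G, so -G is positive definite there. Only
planes inside ker dF matter, which is why `hK` with positive Gram determinant is enough. -/
theorem curvatureForm_hatChart_nonpos (h : IsHomogeneousChart G F X α U) (hα : 1 < α) (β : ℝ)
    (hz : z ∈ U) (hpos : ∀ v, v ≠ 0 → 0 < hatChart G F α β z v v)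
    (hK : ∀ a b, 0 < G z a a * G z b b - G z a b ^ 2 →
      0 ≤ G z (curvatureInChart G z a b b) a) (a b : E) :
    hatChart G F α β z (curvatureInChart (hatChart G F α β) z a b b) a ≤ 0 := by
  have hF := h.pos z hz
  have hr := Real.rpow_pos_of_pos hF β
  rw [h.curvatureForm_hatChart hα β hz a b rfl rfl]
  set a' := a - (fderiv ℝ F z a / (α * F z)) • X z with ha
  set b' := b - (fderiv ℝ F z b / (α * F z)) • X z with hb
  have hker (c : E) : fderiv ℝ F z (c - (fderiv ℝ F z c / (α * F z)) • X z) = 0 := by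
    have : α ≠ 0 := by positivity
    rw [map_sub, map_smul, h.fderiv_field_eq z hz, smul_eq_mul]
    field_simp
    ring
  have hdef (v : E) (hv : fderiv ℝ F z v = 0) (hv0 : v ≠ 0) : 0 < (-G z) v v := by
    have := hpos v hv0
    rw [hatChart_apply, hv] at this
    have h2 := (pos_iff_pos_of_mul_pos this).1 hr
    rw [mul_zero, mul_zero, zero_add] at h2
    simp only [neg_apply]
    nlinarith
  obtain ⟨h1, h2⟩ := gram_nonneg_of_pos_on_ker (B := -G z)
    (fun u v ↦ by simp [h.symm z hz u v]) (fderiv ℝ F z) hdef (hker a) (hker b)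
  rw [← ha, ← hb] at h1 h2
  simp only [neg_apply, neg_mul_neg, neg_sq] at h1 h2
  have h3 : 0 ≤ G z (curvatureInChart G z a' b' b') a' := by
    -- If the Gram determinant vanishes, a' and b' are dependent by the equality case of
    -- Cauchy-Schwarz, and the curvature form is zero by skewness.
    rcases h1.eq_or_lt with h0 | h0
    · rcases h2 h0.symm with hb0 | ⟨t, ht⟩
      · have := h.curvature_smul_right hz 0 a' b' b'
        rw [zero_smul, zero_smul] at this
        rw [hb0] at this ⊢
        simp [this]
      · apply le_of_eq
        rw [h.curvature_pair_symm hz]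
        have h4 := h.curvature_smul_right hz t b' a' b'
        rw [← ht] at h4
        have h5 := h.curvature_skew_right hz b' a' b' b'
        rw [h4, map_smul, smul_apply]
        rw [show G z (curvatureInChart G z b' a' b') b' = 0 by linarith, smul_zero]
    · exact hK a' b' h0
  have h4 : 0 ≤ α * (α - 1) / 4 * (1 + (α - 1) * (β + 1) ^ 2) * (F z)⁻¹ *
      (G z a' a' * G z b' b' - G z a' b' ^ 2) := by
    have : 0 < α - 1 := by linarith
    positivity
  exact mul_nonpos_of_nonneg_of_nonpos hr.le (by nlinarith)

end IsHomogeneousChart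

end HatSign

/-! ### Passing between tensor fields on M and their coordinate expressions. -/

section Transport

set_option maxSynthPendingDepth 3

variable {E : Type*} [NormedAddCommGroup E] [NormedSpace ℝ E]
  {M : Type*} [TopologicalSpace M] [ChartedSpace E M]

/-- The derivative at `q` of the chart at `x₀`, as an endomorphism of the model space. -/
def chartDeriv (x₀ q : M) : E →L[ℝ] E := mfderiv 𝓘(ℝ, E) 𝓘(ℝ, E) (extChartAt 𝓘(ℝ, E) x₀) q

/-- The derivative at `z` of the inverse of the chart at `x₀`, as an endomorphism of the model
space. -/
def chartSymmDeriv (x₀ : M) (z : E) : E →L[ℝ] E :=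
  mfderiv 𝓘(ℝ, E) 𝓘(ℝ, E) (extChartAt 𝓘(ℝ, E) x₀).symm z

theorem inChart_apply (g : TwoTensorField E M) (x₀ : M) (z u v : E) :
    inChart g x₀ z u v =
      g ((extChartAt 𝓘(ℝ, E) x₀).symm z) (chartSymmDeriv x₀ z u) (chartSymmDeriv x₀ z v) := rfl

theorem conformalPow_hatMetric_apply (f : M → ℝ) (g : TwoTensorField E M) (α β : ℝ) (x : M)
    (u v : TangentSpace 𝓘(ℝ, E) x) :
    conformalPow f β (hatMetric g f α) x u v = f x ^ β *
      ((f x)⁻¹ * (differential f x u * differential f x v) + (1 - α) * g x u v) := by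
  rw [conformalPow, hatMetric]
  simp only [smul_apply, add_apply, smul_eq_mul, ContinuousLinearMap.smulRight_apply]

variable [IsManifold 𝓘(ℝ, E) ∞ M] {x₀ : M} {z : E}

theorem chartSymmDeriv_chartDeriv (hz : z ∈ (extChartAt 𝓘(ℝ, E) x₀).target) (v : E) :
    chartSymmDeriv x₀ z (chartDeriv x₀ ((extChartAt 𝓘(ℝ, E) x₀).symm z) v) = v := by
  have := mfderivWithin_extChartAt_symm_comp_mfderiv_extChartAt hz
  rw [ModelWithCorners.range_eq_univ, mfderivWithin_univ] at this
  exact DFunLike.congr_fun this v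

theorem chartDeriv_chartSymmDeriv (hz : z ∈ (extChartAt 𝓘(ℝ, E) x₀).target) (v : E) :
    chartDeriv x₀ ((extChartAt 𝓘(ℝ, E) x₀).symm z) (chartSymmDeriv x₀ z v) = v := by
  have := mfderiv_extChartAt_comp_mfderivWithin_extChartAt_symm hz
  rw [ModelWithCorners.range_eq_univ, mfderivWithin_univ] at this
  exact DFunLike.congr_fun this v

theorem inChart_chartDeriv (g : TwoTensorField E M) {q : M}
    (hq : q ∈ (extChartAt 𝓘(ℝ, E) x₀).source) (u v : E) :
    inChart g x₀ (extChartAt 𝓘(ℝ, E) x₀ q) (chartDeriv x₀ q u) (chartDeriv x₀ q v) =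
      g q u v := by
  obtain ⟨z, hz, rfl⟩ : ∃ z ∈ (extChartAt 𝓘(ℝ, E) x₀).target, (extChartAt 𝓘(ℝ, E) x₀).symm z = q :=
    ⟨_, (extChartAt 𝓘(ℝ, E) x₀).map_source hq, (extChartAt 𝓘(ℝ, E) x₀).left_inv hq⟩
  rw [(extChartAt 𝓘(ℝ, E) x₀).right_inv hz, inChart_apply, chartSymmDeriv_chartDeriv hz,
    chartSymmDeriv_chartDeriv hz]

/-- The trivialization of the tangent bundle at x₀ is the derivative of the chart. This lets
smoothness of a section and smoothness of its coordinate expressions be exchanged in both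
directions. -/
theorem trivializationAt_apply_eq_inChart (g : TwoTensorField E M) {q : M}
    (hq : q ∈ (extChartAt 𝓘(ℝ, E) x₀).source) :
    (trivializationAt (E →L[ℝ] E →L[ℝ] ℝ)
      (fun x : M ↦ TangentSpace 𝓘(ℝ, E) x →L[ℝ] TangentSpace 𝓘(ℝ, E) x →L[ℝ] ℝ) x₀
        ⟨q, g q⟩).2 = inChart g x₀ (extChartAt 𝓘(ℝ, E) x₀ q) := by
  have hq' : q ∈ (chartAt E x₀).source := by rwa [extChartAt_source] at hq
  ext u v
  rw [hom_trivializationAt_apply]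
  simp only
  rw [inCoordinates_apply_eq₂ (by simpa using hq') (by simpa using hq') (by simp)]
  have h := TangentBundle.symmL_trivializationAt (𝕜 := ℝ) (I := 𝓘(ℝ, E)) hq'
  rw [ModelWithCorners.range_eq_univ, mfderivWithin_univ] at h
  have h' (w : E) : (trivializationAt E (TangentSpace 𝓘(ℝ, E)) x₀).symm q w =
      chartSymmDeriv x₀ (extChartAt 𝓘(ℝ, E) x₀ q) w := by
    rw [← Bundle.Trivialization.symmL_apply (R := ℝ) _ (by simpa using hq')]
    exact DFunLike.congr_fun h w
  have hz := (extChartAt 𝓘(ℝ, E) x₀).map_source hq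
  have e (w : E) : chartDeriv x₀ q (chartSymmDeriv x₀ (extChartAt 𝓘(ℝ, E) x₀ q) w) = w := by
    have := chartDeriv_chartSymmDeriv hz w
    rwa [(extChartAt 𝓘(ℝ, E) x₀).left_inv hq] at this
  have key (a b : E) (ha : a = chartSymmDeriv x₀ (extChartAt 𝓘(ℝ, E) x₀ q) u)
      (hb : b = chartSymmDeriv x₀ (extChartAt 𝓘(ℝ, E) x₀ q) v) :
      g q a b = inChart g x₀ (extChartAt 𝓘(ℝ, E) x₀ q) u v := by
    rw [← inChart_chartDeriv (x₀ := x₀) g hq, ha, hb, e, e]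
  rw [key _ _ (h' u) (h' v), Bundle.Trivialization.linearMapAt_apply]
  simp

theorem contDiffOn_inChart {g : TwoTensorField E M}
    (hg : ContMDiff 𝓘(ℝ, E) (𝓘(ℝ, E).prod 𝓘(ℝ, E →L[ℝ] E →L[ℝ] ℝ)) ∞
      (fun x ↦ Bundle.TotalSpace.mk' (E →L[ℝ] E →L[ℝ] ℝ)
        (E := fun x : M ↦ TangentSpace 𝓘(ℝ, E) x →L[ℝ] TangentSpace 𝓘(ℝ, E) x →L[ℝ] ℝ) x (g x)))
    (x₀ : M) : ContDiffOn ℝ ∞ (inChart g x₀) (extChartAt 𝓘(ℝ, E) x₀).target := by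
  have h1 := (Bundle.Trivialization.contMDiffOn_section_baseSet_iff
    (trivializationAt (E →L[ℝ] E →L[ℝ] ℝ)
      (fun x : M ↦ TangentSpace 𝓘(ℝ, E) x →L[ℝ] TangentSpace 𝓘(ℝ, E) x →L[ℝ] ℝ) x₀)).1
        hg.contMDiffOn
  have h2 : Set.MapsTo (extChartAt 𝓘(ℝ, E) x₀).symm (extChartAt 𝓘(ℝ, E) x₀).target
      (trivializationAt (E →L[ℝ] E →L[ℝ] ℝ)
        (fun x : M ↦ TangentSpace 𝓘(ℝ, E) x →L[ℝ] TangentSpace 𝓘(ℝ, E) x →L[ℝ] ℝ) x₀).baseSet := by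
    intro z hz
    have := (extChartAt 𝓘(ℝ, E) x₀).map_target hz
    rw [extChartAt_source] at this
    simpa using this
  have h3 := (h1.comp (contMDiffOn_extChartAt_symm (I := 𝓘(ℝ, E)) (n := ∞) x₀) h2).contDiffOn
  refine h3.congr fun z hz ↦ ?_
  rw [Function.comp_apply, trivializationAt_apply_eq_inChart g
    ((extChartAt 𝓘(ℝ, E) x₀).map_target hz), (extChartAt 𝓘(ℝ, E) x₀).right_inv hz]

theorem contMDiff_of_contDiffOn_inChart {g : TwoTensorField E M}
    (hg : ∀ x₀, ContDiffOn ℝ ∞ (inChart g x₀) (extChartAt 𝓘(ℝ, E) x₀).target) :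
    ContMDiff 𝓘(ℝ, E) (𝓘(ℝ, E).prod 𝓘(ℝ, E →L[ℝ] E →L[ℝ] ℝ)) ∞
      (fun x ↦ Bundle.TotalSpace.mk' (E →L[ℝ] E →L[ℝ] ℝ)
        (E := fun x : M ↦ TangentSpace 𝓘(ℝ, E) x →L[ℝ] TangentSpace 𝓘(ℝ, E) x →L[ℝ] ℝ)
          x (g x)) := by
  intro x₀
  rw [Bundle.contMDiffAt_section]
  have h1 : ContMDiffAt 𝓘(ℝ, E) 𝓘(ℝ, E →L[ℝ] E →L[ℝ] ℝ) ∞ (inChart g x₀)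
      (extChartAt 𝓘(ℝ, E) x₀ x₀) :=
    ((hg x₀).contDiffAt (extChartAt_target_mem_nhds x₀)).contMDiffAt
  refine (h1.comp x₀ contMDiffAt_extChartAt).congr_of_eventuallyEq ?_
  filter_upwards [extChartAt_source_mem_nhds (I := 𝓘(ℝ, E)) x₀] with q hq
    using trivializationAt_apply_eq_inChart g hq

theorem differential_apply_chartSymmDeriv {f : M → ℝ} (hf : ContMDiff 𝓘(ℝ, E) 𝓘(ℝ, ℝ) ∞ f)
    (hz : z ∈ (extChartAt 𝓘(ℝ, E) x₀).target) (v : E) :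
    differential f ((extChartAt 𝓘(ℝ, E) x₀).symm z) (chartSymmDeriv x₀ z v) =
      fderiv ℝ (f ∘ (extChartAt 𝓘(ℝ, E) x₀).symm) z v := by
  have h1 : MDifferentiableAt 𝓘(ℝ, E) 𝓘(ℝ, E) (extChartAt 𝓘(ℝ, E) x₀).symm z := by
    have := mdifferentiableWithinAt_extChartAt_symm hz
    rwa [ModelWithCorners.range_eq_univ, mdifferentiableWithinAt_univ] at this
  have h2 := mfderiv_comp z (hf.mdifferentiable (by simp) _) h1
  rw [mfderiv_eq_fderiv] at h2
  exact (DFunLike.congr_fun h2 v).symm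

theorem inChart_conformalPow_hatMetric {f : M → ℝ} (hf : ContMDiff 𝓘(ℝ, E) 𝓘(ℝ, ℝ) ∞ f)
    (g : TwoTensorField E M) (α β : ℝ) (hz : z ∈ (extChartAt 𝓘(ℝ, E) x₀).target) :
    inChart (conformalPow f β (hatMetric g f α)) x₀ z =
      hatChart (inChart g x₀) (f ∘ (extChartAt 𝓘(ℝ, E) x₀).symm) α β z := by
  ext u v
  rw [inChart_apply, hatChart_apply, ← differential_apply_chartSymmDeriv hf hz,
    ← differential_apply_chartSymmDeriv hf hz, inChart_apply]
  exact conformalPow_hatMetric_apply f g α β _ _ _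

end Transport

/-! ### The flow of the action in a chart, and the infinitesimal form of homogeneity. -/

section Flow

set_option maxSynthPendingDepth 3

variable {E : Type*} [NormedAddCommGroup E] [NormedSpace ℝ E]
  {M : Type*} [TopologicalSpace M] [ChartedSpace E M]

/-- The flow `(t, x) ↦ m (exp t) x` of an action, in the chart at `x₀`. -/
def flowChart (m : ℝ → M → M) (x₀ : M) (p : ℝ × E) : E :=
  extChartAt 𝓘(ℝ, E) x₀ (m (Real.exp p.1) ((extChartAt 𝓘(ℝ, E) x₀).symm p.2))

/-- The generator of an action, in the chart at `x₀`. -/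
def generatorChart (m : ℝ → M → M) (x₀ : M) (z : E) : E :=
  chartDeriv x₀ ((extChartAt 𝓘(ℝ, E) x₀).symm z) (generator m ((extChartAt 𝓘(ℝ, E) x₀).symm z))

variable {m : ℝ → M → M} {x₀ : M} {z : E}

/-- If the flow `Φ` rescales `G` by `exp (α t)`, then the Lie derivative of `G` along the velocity
of `Φ` is `α G`. -/
theorem lie_of_flow_homogeneous {G : E → E →L[ℝ] E →L[ℝ] ℝ} {Φ : ℝ × E → E} {α : ℝ} {u v : E}
    (hG : DifferentiableAt ℝ G z) (hΦ : ContDiffAt ℝ ∞ Φ (0, z)) (h0 : Φ (0, z) = z)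
    (h1 : ∀ u, fderiv ℝ Φ (0, z) (0, u) = u)
    (h : ∀ᶠ t in nhds (0 : ℝ), G (Φ (t, z)) (fderiv ℝ Φ (t, z) (0, u)) (fderiv ℝ Φ (t, z) (0, v)) =
      Real.exp (t * α) * G z u v) :
    fderiv ℝ G z (fderiv ℝ Φ (0, z) (1, 0)) u v
      + G z (fderiv ℝ (fderiv ℝ Φ) (0, z) (1, 0) (0, u)) v
      + G z u (fderiv ℝ (fderiv ℝ Φ) (0, z) (1, 0) (0, v)) = α * G z u v := by
  have hd := hΦ.differentiableAt (by simp)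
  have hd2 := ((hΦ.fderiv_right (m := ∞) (by simp)).differentiableAt (by simp)).hasFDerivAt
  have hl : HasDerivAt (fun t : ℝ ↦ ((t, z) : ℝ × E)) ((1 : ℝ), (0 : E)) 0 :=
    (hasDerivAt_id 0).prodMk (hasDerivAt_const 0 z)
  have h2 := hd.hasFDerivAt.comp_hasDerivAt (0 : ℝ) hl
  have hG' : HasFDerivAt G (fderiv ℝ G z) (Φ (0, z)) := by rw [h0]; exact hG.hasFDerivAt
  have h3 := hG'.comp_hasDerivAt (0 : ℝ) h2
  have h4 (w : E) : HasDerivAt (fun t ↦ fderiv ℝ Φ (t, z) (0, w))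
      (fderiv ℝ (fderiv ℝ Φ) (0, z) (1, 0) (0, w)) (0 : ℝ) := by
    have := (hd2.clm_apply (hasFDerivAt_const ((0 : ℝ), w) (0, z))).comp_hasDerivAt (0 : ℝ) hl
    simpa [Function.comp_def] using this
  have h5 := (h3.clm_apply (h4 u)).clm_apply (h4 v)
  have h6 : HasDerivAt (fun t : ℝ ↦ Real.exp (t * α) * G z u v) (α * G z u v) 0 := by
    simpa using (((hasDerivAt_id (0 : ℝ)).mul_const α).exp).mul_const (G z u v)
  have h7 := h5.unique (h6.congr_of_eventuallyEq h)
  simp only [Function.comp_apply, h0, add_apply, h1] at h7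
  exact h7

theorem IsSmoothFreeAction.contMDiffAt (h : IsSmoothFreeAction (E := E) m) {l : ℝ} (hl : 0 < l)
    (x : M) : ContMDiffAt (𝓘(ℝ, ℝ).prod 𝓘(ℝ, E)) 𝓘(ℝ, E) ∞ (fun p : ℝ × M ↦ m p.1 p.2) (l, x) :=
  h.smooth.contMDiffAt ((isOpen_Ioi.prod isOpen_univ).mem_nhds ⟨hl, trivial⟩)

theorem IsSmoothFreeAction.contMDiffAt_apply (h : IsSmoothFreeAction (E := E) m) {l : ℝ}
    (hl : 0 < l) (x : M) : ContMDiffAt 𝓘(ℝ, E) 𝓘(ℝ, E) ∞ (m l) x :=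
  (h.contMDiffAt hl x).comp x (contMDiffAt_const.prodMk contMDiffAt_id)

theorem IsSmoothFreeAction.contMDiffAt_orbit (h : IsSmoothFreeAction (E := E) m) (t : ℝ) (x : M) :
    ContMDiffAt 𝓘(ℝ, ℝ) 𝓘(ℝ, E) ∞ (fun t ↦ m (Real.exp t) x) t :=
  (h.contMDiffAt (Real.exp_pos t) x).comp t
    (Real.contDiff_exp.contDiffAt.contMDiffAt.prodMk contMDiffAt_const)

theorem flowChart_zero (h : IsSmoothFreeAction (E := E) m)
    (hz : z ∈ (extChartAt 𝓘(ℝ, E) x₀).target) : flowChart m x₀ (0, z) = z := by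
  simp only [flowChart, Real.exp_zero, h.one, (extChartAt 𝓘(ℝ, E) x₀).right_inv hz]

theorem eventually_mem_source (h : IsSmoothFreeAction (E := E) m)
    (hz : z ∈ (extChartAt 𝓘(ℝ, E) x₀).target) :
    ∀ᶠ t in nhds (0 : ℝ), m (Real.exp t) ((extChartAt 𝓘(ℝ, E) x₀).symm z) ∈
      (extChartAt 𝓘(ℝ, E) x₀).source := by
  refine (h.contMDiffAt_orbit 0 _).continuousAt.eventually_mem
    ((isOpen_extChartAt_source x₀).mem_nhds ?_)
  rw [Real.exp_zero, h.one]
  exact (extChartAt 𝓘(ℝ, E) x₀).map_target hz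

variable [IsManifold 𝓘(ℝ, E) ∞ M]

theorem contDiffAt_flowChart (h : IsSmoothFreeAction (E := E) m) {t : ℝ}
    (hz : z ∈ (extChartAt 𝓘(ℝ, E) x₀).target)
    (ht : m (Real.exp t) ((extChartAt 𝓘(ℝ, E) x₀).symm z) ∈ (extChartAt 𝓘(ℝ, E) x₀).source) :
    ContDiffAt ℝ ∞ (flowChart m x₀) (t, z) := by
  rw [← contMDiffAt_iff_contDiffAt]
  have h1 : ContMDiffAt 𝓘(ℝ, ℝ × E) 𝓘(ℝ, ℝ) ∞ (fun p : ℝ × E ↦ Real.exp p.1) (t, z) :=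
    (Real.contDiff_exp.comp contDiff_fst).contDiffAt.contMDiffAt
  have h2 : ContMDiffAt 𝓘(ℝ, ℝ × E) 𝓘(ℝ, E) ∞
      (fun p : ℝ × E ↦ (extChartAt 𝓘(ℝ, E) x₀).symm p.2) (t, z) :=
    ((contMDiffOn_extChartAt_symm x₀).contMDiffAt
      ((isOpen_extChartAt_target x₀).mem_nhds hz)).comp (t, z)
        contDiff_snd.contDiffAt.contMDiffAt
  have h3 : ContMDiffAt 𝓘(ℝ, ℝ × E) 𝓘(ℝ, E) ∞
      (fun p : ℝ × E ↦ m (Real.exp p.1) ((extChartAt 𝓘(ℝ, E) x₀).symm p.2)) (t, z) :=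
    (h.contMDiffAt (Real.exp_pos t) _).comp (t, z) (h1.prodMk h2)
  rw [extChartAt_source] at ht
  exact (contMDiffAt_extChartAt' ht).comp (t, z) h3

theorem fderiv_flowChart_zero_left (h : IsSmoothFreeAction (E := E) m)
    (hz : z ∈ (extChartAt 𝓘(ℝ, E) x₀).target) :
    fderiv ℝ (flowChart m x₀) (0, z) (1, 0) = generatorChart m x₀ z := by
  set q := (extChartAt 𝓘(ℝ, E) x₀).symm z with hq
  have hq0 : m (Real.exp 0) q = q := by rw [Real.exp_zero, h.one]
  have hs := (extChartAt 𝓘(ℝ, E) x₀).map_target hz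
  have hd := (contDiffAt_flowChart h (t := 0) hz (by rw [← hq, hq0]; exact hs)).differentiableAt
    (by simp)
  have h1 : HasFDerivAt (fun t : ℝ ↦ ((t, z) : ℝ × E)) (.inl ℝ ℝ E) 0 :=
    hasFDerivAt_prodMk_left 0 z
  have h2 := (hd.hasFDerivAt.comp (0 : ℝ) h1).fderiv
  rw [extChartAt_source] at hs
  have h3 := mfderiv_comp_of_eq (x := (0 : ℝ)) (y := q)
    (mdifferentiableAt_extChartAt (I := 𝓘(ℝ, E)) hs)
    ((h.contMDiffAt_orbit 0 q).mdifferentiableAt (by simp)) hq0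
  -- m (exp 0) q is only propositionally equal to q, so the chart derivative is transported along
  -- that equality.
  have h4 : ∀ q' : M, q' = q →
      (chartDeriv x₀ q' : E →L[ℝ] E) = chartDeriv x₀ q := by rintro _ rfl; rfl
  have h5 := DFunLike.congr_fun h2 1
  have h6 := DFunLike.congr_fun h3 (1 : ℝ)
  rw [mfderiv_eq_fderiv] at h6
  have h7 : fderiv ℝ (flowChart m x₀) (0, z) (1, 0) = fderiv ℝ (flowChart m x₀ ∘ fun t ↦ (t, z))
      0 1 := by simpa using h5.symm
  rw [h7]
  refine h6.trans ?_
  rw [generatorChart, ← hq, ← h4 _ hq0]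
  rfl

/-- Chain rule that exhibits the differential of m_λ, λ = exp t, so that the hypothesis m_λ^* g =
λ^α g applies to the flow in the chart. -/
theorem fderiv_flowChart_right (h : IsSmoothFreeAction (E := E) m) {t : ℝ}
    (hz : z ∈ (extChartAt 𝓘(ℝ, E) x₀).target)
    (ht : m (Real.exp t) ((extChartAt 𝓘(ℝ, E) x₀).symm z) ∈ (extChartAt 𝓘(ℝ, E) x₀).source)
    (u : E) : fderiv ℝ (flowChart m x₀) (t, z) (0, u) =
      chartDeriv (E := E) x₀ (m (Real.exp t) ((extChartAt 𝓘(ℝ, E) x₀).symm z))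
        ((mfderiv 𝓘(ℝ, E) 𝓘(ℝ, E) (m (Real.exp t)) ((extChartAt 𝓘(ℝ, E) x₀).symm z) :
          E →L[ℝ] E) (chartSymmDeriv x₀ z u)) := by
  have hd := (contDiffAt_flowChart h hz ht).differentiableAt (by simp)
  have h1 : HasFDerivAt (fun y : E ↦ ((t, y) : ℝ × E)) (.inr ℝ ℝ E) z :=
    hasFDerivAt_prodMk_right t z
  have h2 := (hd.hasFDerivAt.comp z h1).fderiv
  have hsymm : MDifferentiableAt 𝓘(ℝ, E) 𝓘(ℝ, E) (extChartAt 𝓘(ℝ, E) x₀).symm z := by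
    have := mdifferentiableWithinAt_extChartAt_symm hz
    rwa [ModelWithCorners.range_eq_univ, mdifferentiableWithinAt_univ] at this
  rw [extChartAt_source] at ht
  have hm := (h.contMDiffAt_apply (Real.exp_pos t)
    ((extChartAt 𝓘(ℝ, E) x₀).symm z)).mdifferentiableAt (by simp)
  have h3 := mfderiv_comp z (mdifferentiableAt_extChartAt (I := 𝓘(ℝ, E)) ht) (hm.comp z hsymm)
  rw [mfderiv_comp z hm hsymm, mfderiv_eq_fderiv] at h3
  have h7 : fderiv ℝ (flowChart m x₀) (t, z) (0, u) = fderiv ℝ (flowChart m x₀ ∘ fun y ↦ (t, y))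
      z u := by simpa using (DFunLike.congr_fun h2 u).symm
  rw [h7]
  exact DFunLike.congr_fun h3 u

theorem fderiv_flowChart_zero_right (h : IsSmoothFreeAction (E := E) m)
    (hz : z ∈ (extChartAt 𝓘(ℝ, E) x₀).target) (u : E) :
    fderiv ℝ (flowChart m x₀) (0, z) (0, u) = u := by
  have hd := (contDiffAt_flowChart h (t := 0) hz (by
    rw [Real.exp_zero, h.one]; exact (extChartAt 𝓘(ℝ, E) x₀).map_target hz)).differentiableAt
    (by simp)
  have h1 : HasFDerivAt (fun y : E ↦ (((0 : ℝ), y) : ℝ × E)) (.inr ℝ ℝ E) z :=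
    hasFDerivAt_prodMk_right 0 z
  have h2 := (hd.hasFDerivAt.comp z h1).fderiv
  have h3 : (flowChart m x₀ ∘ fun y ↦ ((0 : ℝ), y)) =ᶠ[nhds z] id := by
    filter_upwards [(isOpen_extChartAt_target x₀).mem_nhds hz] with y hy
      using flowChart_zero h hy
  rw [h3.fderiv_eq, fderiv_id] at h2
  simpa using (DFunLike.congr_fun h2 u).symm

/-- The second derivative of the flow: `∂ₜ` of its space derivative is the derivative of the
generator. -/
theorem differentiableAt_generatorChart_and_fderiv (h : IsSmoothFreeAction (E := E) m)
    (hz : z ∈ (extChartAt 𝓘(ℝ, E) x₀).target) :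
    DifferentiableAt ℝ (generatorChart m x₀) z ∧ ∀ u, fderiv ℝ (generatorChart m x₀) z u =
      fderiv ℝ (fderiv ℝ (flowChart m x₀)) (0, z) (1, 0) (0, u) := by
  have hc := contDiffAt_flowChart h (t := 0) hz (by
    rw [Real.exp_zero, h.one]; exact (extChartAt 𝓘(ℝ, E) x₀).map_target hz)
  have h2 := ((hc.fderiv_right (m := ∞) (by simp)).differentiableAt (by simp)).hasFDerivAt
  have h1 : HasFDerivAt (fun y : E ↦ (((0 : ℝ), y) : ℝ × E)) (.inr ℝ ℝ E) z :=
    hasFDerivAt_prodMk_right 0 z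
  have h3 := (h2.comp z h1).clm_apply (hasFDerivAt_const ((1 : ℝ), (0 : E)) z)
  have h4 : generatorChart m x₀ =ᶠ[nhds z]
      fun y ↦ (fderiv ℝ (flowChart m x₀) ∘ fun y ↦ ((0 : ℝ), y)) y ((1 : ℝ), (0 : E)) := by
    filter_upwards [(isOpen_extChartAt_target x₀).mem_nhds hz] with y hy
      using (fderiv_flowChart_zero_left h hy).symm
  have h5 := h3.congr_of_eventuallyEq h4
  refine ⟨h5.differentiableAt, fun u ↦ ?_⟩
  -- Near z the generator is ∂ₜΦ(0, ·) for the flow Φ; symmetry of second derivatives exchanges ∂_u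
  -- and ∂ₜ.
  have hs := (hc.isSymmSndFDerivAt (by
    rw [minSmoothness_of_isRCLikeNormedField]; exact WithTop.coe_le_coe.2 (le_top (a := 2)))).eq
      ((1 : ℝ), (0 : E)) (0, u)
  rw [h5.fderiv, hs]
  simp

theorem IsPseudoRiemannianMetric.bijective_inChart {g : TwoTensorField E M}
    (h : IsPseudoRiemannianMetric g) (hz : z ∈ (extChartAt 𝓘(ℝ, E) x₀).target) :
    Function.Bijective (inChart g x₀ z) := by
  have hb := h.nondegenerate ((extChartAt 𝓘(ℝ, E) x₀).symm z)
  have e (v : E) := chartSymmDeriv_chartDeriv hz v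
  have e' (v : E) := chartDeriv_chartSymmDeriv hz v
  constructor
  · intro u v huv
    have : chartSymmDeriv x₀ z u = chartSymmDeriv x₀ z v := hb.1 <| by
      ext w
      have := DFunLike.congr_fun huv (chartDeriv (E := E) x₀ ((extChartAt 𝓘(ℝ, E) x₀).symm z) w)
      have key (a : E) : inChart g x₀ z a
          (chartDeriv (E := E) x₀ ((extChartAt 𝓘(ℝ, E) x₀).symm z) w) =
            g ((extChartAt 𝓘(ℝ, E) x₀).symm z) (chartSymmDeriv x₀ z a) w :=
        congrArg (fun y : E ↦ g ((extChartAt 𝓘(ℝ, E) x₀).symm z) (chartSymmDeriv x₀ z a) y) (e w)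
      exact (key u).symm.trans (this.trans (key v))
    rw [← e' u, this, e']
  · intro ξ
    obtain ⟨v, hv⟩ := hb.2 (ξ ∘L chartDeriv (E := E) x₀ ((extChartAt 𝓘(ℝ, E) x₀).symm z))
    refine ⟨chartDeriv (E := E) x₀ ((extChartAt 𝓘(ℝ, E) x₀).symm z) v, ?_⟩
    ext w
    rw [inChart_apply]
    refine (congrArg (fun y : E ↦ g _ y (chartSymmDeriv x₀ z w)) (e v)).trans ?_
    refine (DFunLike.congr_fun hv _).trans ?_
    exact congrArg ξ (e' w)

namespace IsHomogeneousPair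

variable {g : TwoTensorField E M} {f : M → ℝ} {α : ℝ}

theorem contDiffOn_fun (h : IsHomogeneousPair m g f α) (x₀ : M) :
    ContDiffOn ℝ ∞ (f ∘ (extChartAt 𝓘(ℝ, E) x₀).symm) (extChartAt 𝓘(ℝ, E) x₀).target := by
  rw [← contMDiffOn_iff_contDiffOn]
  exact h.smooth.comp_contMDiffOn (contMDiffOn_extChartAt_symm x₀)

/-- Euler's identity df(P) = αf: the derivative at t = 0 of f(m (exp t) x) = exp(tα) f(x). -/
theorem fderiv_fun_generatorChart (h : IsHomogeneousPair m g f α)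
    (hz : z ∈ (extChartAt 𝓘(ℝ, E) x₀).target) :
    fderiv ℝ (f ∘ (extChartAt 𝓘(ℝ, E) x₀).symm) z (generatorChart m x₀ z) =
      α * (f ∘ (extChartAt 𝓘(ℝ, E) x₀).symm) z := by
  have hF : DifferentiableAt ℝ (f ∘ (extChartAt 𝓘(ℝ, E) x₀).symm) z :=
    ((h.contDiffOn_fun x₀).contDiffAt ((isOpen_extChartAt_target x₀).mem_nhds hz)).differentiableAt
      (by simp)
  have hd := (contDiffAt_flowChart h.action (t := 0) hz (by
    rw [Real.exp_zero, h.action.one]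
    exact (extChartAt 𝓘(ℝ, E) x₀).map_target hz)).differentiableAt (by simp)
  have h1 : HasDerivAt (fun t : ℝ ↦ ((t, z) : ℝ × E)) ((1 : ℝ), (0 : E)) 0 :=
    (hasDerivAt_id 0).prodMk (hasDerivAt_const 0 z)
  have h2 := hd.hasFDerivAt.comp_hasDerivAt (0 : ℝ) h1
  rw [fderiv_flowChart_zero_left h.action hz] at h2
  rw [← flowChart_zero h.action hz] at hF
  have h3 := hF.hasFDerivAt.comp_hasDerivAt (0 : ℝ) h2
  rw [flowChart_zero h.action hz] at h3
  have h4 : HasDerivAt (fun t : ℝ ↦ Real.exp (t * α) *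
      f ((extChartAt 𝓘(ℝ, E) x₀).symm z)) (α * f ((extChartAt 𝓘(ℝ, E) x₀).symm z)) 0 := by
    simpa using (((hasDerivAt_id (0 : ℝ)).mul_const α).exp).mul_const
      (f ((extChartAt 𝓘(ℝ, E) x₀).symm z))
  refine h3.unique (h4.congr_of_eventuallyEq ?_)
  filter_upwards [eventually_mem_source h.action hz] with t ht
  simp only [Function.comp_apply, flowChart, (extChartAt 𝓘(ℝ, E) x₀).left_inv ht,
    h.homogeneous_fun _ (Real.exp_pos t), Real.exp_mul]

/-- The derivative at λ = 1 of m_λ^* g = λ^α g, that is, L_P g = αg. -/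
theorem lie_inChart (h : IsHomogeneousPair m g f α)
    (hz : z ∈ (extChartAt 𝓘(ℝ, E) x₀).target) (u v : E) :
    fderiv ℝ (inChart g x₀) z (generatorChart m x₀ z) u v
      + inChart g x₀ z (fderiv ℝ (generatorChart m x₀) z u) v
      + inChart g x₀ z u (fderiv ℝ (generatorChart m x₀) z v) = α * inChart g x₀ z u v := by
  have hG := ((contDiffOn_inChart h.metric.smooth x₀).contDiffAt
    ((isOpen_extChartAt_target x₀).mem_nhds hz)).differentiableAt (by simp)
  have hc := contDiffAt_flowChart h.action (t := 0) hz (by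
    rw [Real.exp_zero, h.action.one]; exact (extChartAt 𝓘(ℝ, E) x₀).map_target hz)
  have key := lie_of_flow_homogeneous hG hc (flowChart_zero h.action hz)
    (fderiv_flowChart_zero_right h.action hz) (α := α) (u := u) (v := v) (by
      filter_upwards [eventually_mem_source h.action hz] with t ht
      rw [fderiv_flowChart_right h.action hz ht, fderiv_flowChart_right h.action hz ht]
      exact (inChart_chartDeriv g ht _ _).trans
        ((h.homogeneous_metric _ (Real.exp_pos t) _ _ _).trans
          (by rw [inChart_apply, Real.exp_mul])))
  rwa [fderiv_flowChart_zero_left h.action hz,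
    ← (differentiableAt_generatorChart_and_fderiv h.action hz).2,
    ← (differentiableAt_generatorChart_and_fderiv h.action hz).2] at key

theorem isHomogeneousChart (h : IsHomogeneousPair m g f α) (x₀ : M) :
    IsHomogeneousChart (inChart g x₀) (f ∘ (extChartAt 𝓘(ℝ, E) x₀).symm) (generatorChart m x₀) α
      (extChartAt 𝓘(ℝ, E) x₀).target where
  isOpen := isOpen_extChartAt_target x₀
  smooth := contDiffOn_inChart h.metric.smooth x₀
  symm z hz u v := by
    rw [inChart_apply, inChart_apply]
    exact h.metric.symm _ _ _
  bijective z hz := h.metric.bijective_inChart hz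
  smooth_fun := h.contDiffOn_fun x₀
  pos z hz := h.pos _
  differentiable_field z hz := (differentiableAt_generatorChart_and_fderiv h.action hz).1
  field_eq z hz := by
    ext v
    rw [← differential_apply_chartSymmDeriv h.smooth hz, inChart_apply, ← h.generator_eq]
    exact congrArg (fun y : E ↦ g ((extChartAt 𝓘(ℝ, E) x₀).symm z) y (chartSymmDeriv x₀ z v))
      (chartSymmDeriv_chartDeriv hz _)
  fderiv_field_eq z hz := h.fderiv_fun_generatorChart hz
  lie z hz := h.lie_inChart hz

end IsHomogeneousPair

end Flow

/-! ### Positivity of ĝ and the curvature bound on M. -/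

section Main

set_option maxSynthPendingDepth 3

variable {E : Type*} [NormedAddCommGroup E] [NormedSpace ℝ E]
  {M : Type*} [TopologicalSpace M] [ChartedSpace E M] [IsManifold 𝓘(ℝ, E) ∞ M]
  {m : ℝ → M → M} {g : TwoTensorField E M} {f : M → ℝ} {α : ℝ}

/-- Curvature involves two derivatives of the metric, so agreement on a neighbourhood is needed, not
just at z. -/
theorem curvatureInChart_congr {G H : E → E →L[ℝ] E →L[ℝ] ℝ} {z : E} (h : G =ᶠ[nhds z] H)
    (u v w : E) : curvatureInChart G z u v w = curvatureInChart H z u v w := by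
  have hc (a b : E) : (fun y ↦ christoffel G y a b) =ᶠ[nhds z] fun y ↦ christoffel H y a b := by
    filter_upwards [h, h.fderiv (𝕜 := ℝ)] with y h1 h2
    simp only [christoffel, koszulForm, h1, h2]
  have hc' (a b : E) : christoffel G z a b = christoffel H z a b := (hc a b).eq_of_nhds
  simp only [curvatureInChart, (hc _ _).fderiv_eq, hc']

theorem IsHomogeneousPair.differential_generator (h : IsHomogeneousPair m g f α) (x : M) :
    differential f x (generator (E := E) m x) = α * f x := by
  have hz := (extChartAt 𝓘(ℝ, E) x).map_source (mem_extChartAt_source x)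
  have h1 := h.fderiv_fun_generatorChart hz
  rw [← differential_apply_chartSymmDeriv h.smooth hz] at h1
  have h2 : differential f ((extChartAt 𝓘(ℝ, E) x).symm (extChartAt 𝓘(ℝ, E) x x))
      (generator (E := E) m ((extChartAt 𝓘(ℝ, E) x).symm (extChartAt 𝓘(ℝ, E) x x))) =
        α * f ((extChartAt 𝓘(ℝ, E) x).symm (extChartAt 𝓘(ℝ, E) x x)) :=
    (congrArg (fun y : E ↦ differential f
      ((extChartAt 𝓘(ℝ, E) x).symm (extChartAt 𝓘(ℝ, E) x x)) y)
        (chartSymmDeriv_chartDeriv hz _)).symm.trans h1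
  rwa [extChartAt_to_inv] at h2

/-- A definite `ĝ` is positive definite, since `ĝ(P, P) = α f`. -/
theorem IsHomogeneousPair.conformalPow_hatMetric_pos (h : IsHomogeneousPair m g f α) (hα : 1 < α)
    (hdef : IsDefinite (hatMetric g f α)) (β : ℝ) (x : M) (v : TangentSpace 𝓘(ℝ, E) x)
    (hv : v ≠ 0) : 0 < conformalPow f β (hatMetric g f α) x v v := by
  have hf := h.pos x
  have hP := h.differential_generator x
  have hα0 : 0 < α := by linarith
  have hPP : hatMetric g f α x (generator (E := E) m x) (generator (E := E) m x) = α * f x := by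
    have h1 := conformalPow_hatMetric_apply f g α 0 x (generator (E := E) m x)
      (generator (E := E) m x)
    rw [h.generator_eq, hP] at h1
    simp only [conformalPow, Real.rpow_zero, one_smul, one_mul] at h1
    rw [h1]
    field_simp
    ring
  have h1 : 0 < hatMetric g f α x v v := by
    rcases hdef with hd | hd
    · exact hd x v hv
    · have hP0 : generator (E := E) m x ≠ (0 : TangentSpace 𝓘(ℝ, E) x) := by
        intro h0
        rw [h0, map_zero] at hP
        exact (mul_pos hα0 hf).ne hP
      have := hd x _ hP0
      rw [hPP] at this
      exact absurd this (mul_pos hα0 hf).le.not_gt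
  exact mul_pos (Real.rpow_pos_of_pos hf β) h1

theorem IsHomogeneousPair.isPseudoRiemannianMetric_conformalPow [CompleteSpace E]
    (h : IsHomogeneousPair m g f α) (hα : 1 < α) (β : ℝ) :
    IsPseudoRiemannianMetric (conformalPow f β (hatMetric g f α)) where
  smooth := contMDiff_of_contDiffOn_inChart fun x₀ ↦
    ((h.isHomogeneousChart x₀).isChartMetric_hatChart hα.ne' β).smooth.congr fun _ hz ↦
      inChart_conformalPow_hatMetric h.smooth g α β hz
  symm x u v := by
    rw [conformalPow_hatMetric_apply, conformalPow_hatMetric_apply, h.metric.symm x u v,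
      mul_comm (differential f x u)]
  nondegenerate x := bijective_smulRight_add (h.metric.nondegenerate x) (h.generator_eq x)
    (h.differential_generator x) (h.pos x).ne' hα.ne' (Real.rpow_pos_of_pos (h.pos x) β).ne'

theorem IsHomogeneousPair.curvatureForm_nonpos [CompleteSpace E]
    (h : IsHomogeneousPair m g f α) (hα : 1 < α)
    (hK : ∀ (x : M) (a b : TangentSpace 𝓘(ℝ, E) x),
      gramDet g x a b ≠ 0 → 0 ≤ sectionalCurvature g x a b)
    (hdef : IsDefinite (hatMetric g f α)) (β : ℝ) (x : M) (a b : TangentSpace 𝓘(ℝ, E) x) :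
    curvatureForm (conformalPow f β (hatMetric g f α)) x a b ≤ 0 := by
  have hs := mem_extChartAt_source (I := 𝓘(ℝ, E)) x
  have hz := (extChartAt 𝓘(ℝ, E) x).map_source hs
  have hG := h.isHomogeneousChart x
  -- Tangent vectors at x are by definition coordinates in the preferred chart at x, so at its
  -- centre the chart has identity derivative and coordinate expressions equal the tensors
  -- themselves.
  have hid (v : E) : chartDeriv x x v = v :=
    DFunLike.congr_fun (mfderiv_extChartAt_self (𝕜 := ℝ) (I := 𝓘(ℝ, E)) (x := x)) v
  have e (t : TwoTensorField E M) (u v : E) :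
      inChart t x (extChartAt 𝓘(ℝ, E) x x) u v = t x u v := by
    have := inChart_chartDeriv t hs u v
    rwa [hid, hid] at this
  have hcoord (v : E) : tangentCoord x v = v := hid v
  have hchart : inChart (conformalPow f β (hatMetric g f α)) x =ᶠ[nhds (extChartAt 𝓘(ℝ, E) x x)]
      hatChart (inChart g x) (f ∘ (extChartAt 𝓘(ℝ, E) x).symm) α β := by
    filter_upwards [(isOpen_extChartAt_target x).mem_nhds hz] with z hz
      using inChart_conformalPow_hatMetric h.smooth g α β hz
  have hc (u v w : E) := curvatureInChart_congr hchart u v w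
  have hform : curvatureForm (conformalPow f β (hatMetric g f α)) x a b =
      hatChart (inChart g x) (f ∘ (extChartAt 𝓘(ℝ, E) x).symm) α β (extChartAt 𝓘(ℝ, E) x x)
        (curvatureInChart (hatChart (inChart g x) (f ∘ (extChartAt 𝓘(ℝ, E) x).symm) α β)
          (extChartAt 𝓘(ℝ, E) x x) (tangentCoord x a) (tangentCoord x b) (tangentCoord x b))
        (tangentCoord x a) := by
    simp only [curvatureForm, hc, hchart.eq_of_nhds]
  rw [hform]
  refine hG.curvatureForm_hatChart_nonpos hα β hz (fun v hv ↦ ?_) (fun u v huv ↦ ?_) _ _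
  · rw [← hchart.eq_of_nhds, e]
    exact h.conformalPow_hatMetric_pos hα hdef β x v hv
  · rw [e, e, e] at huv
    have h1 : 0 ≤ curvatureForm g x u v / gramDet g x u v := hK x u v huv.ne'
    have h2 : 0 ≤ curvatureForm g x u v := by
      by_contra! hneg
      exact h1.not_gt (div_neg_of_neg_of_pos hneg huv)
    simpa only [curvatureForm, hcoord] using h2

end Main

end

theorem corollary3p15
    {E : Type*} [NormedAddCommGroup E] [NormedSpace ℝ E] [CompleteSpace E]
    {M : Type*} [TopologicalSpace M] [ChartedSpace E M] [IsManifold 𝓘(ℝ, E) ∞ M]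
    (m : ℝ → M → M) (g : TwoTensorField E M) (f : M → ℝ) (α : ℝ)
    (hpair : IsHomogeneousPair m g f α) (hα : 1 < α)
    (hK : ∀ (x : M) (a b : TangentSpace 𝓘(ℝ, E) x),
      gramDet g x a b ≠ 0 → 0 ≤ sectionalCurvature g x a b)
    (hdef : IsDefinite (hatMetric g f α)) (β : ℝ) :
    IsPseudoRiemannianMetric (conformalPow f β (hatMetric g f α)) ∧
      ∀ (x : M) (a b : TangentSpace 𝓘(ℝ, E) x),
        gramDet (conformalPow f β (hatMetric g f α)) x a b ≠ 0 →
          sectionalCurvature (conformalPow f β (hatMetric g f α)) x a b ≤ 0 := by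
  have hm := hpair.isPseudoRiemannianMetric_conformalPow hα β
  refine ⟨hm, fun x a b _ ↦ ?_⟩
  refine div_nonpos_of_nonpos_of_nonneg (hpair.curvatureForm_nonpos hα hK hdef β x a b) ?_
  -- The zero form has the whole tangent space as kernel, so this is plain Cauchy-Schwarz for the
  -- positive definite f^β ĝ.
  exact (gram_nonneg_of_pos_on_ker (hm.symm x) 0
    (fun v _ ↦ hpair.conformalPow_hatMetric_pos hα hdef β x v) rfl rfl).1
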